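/- **Conventions.** Let $\Lambda^m_sV\subset\Lambda^mV$ be the cone of simple $m$-vectors of a finite dimensional real vector space $V$. An $m$-density $G$ on $\mathbb{R}^n$ is a continuous map $(y,\xi)\mapsto G(y,\xi)\in[0,\infty)$ on $\mathbb{R}^n\times\Lambda^m_s\mathbb{R}^n$ with $G(y,\xi)=0$ if and only if $\xi=0$, and $G(y,a\xi)=a\,G(y,\xi)$ for all $a\ge 0$; it is symmetric if $G(y,-\xi)=G(y,\xi)$. Put $e=e_1\wedge\dots\wedge e_m\in\Lambda^m\mathbb{R}^m$. An $m$-density $F$ on $\mathbb{R}^m$ defines the measure $dF(x)=F(x,e)\,dx$. For a linear map $L:\mathbb{R}^m\to\mathbb{R}^n$, $J(L;F_x,G_y)=G(y,\Lambda^mL(\xi))$, where $\xi$ is the positive multiple of $e$ with $F(x,\xi)=1$; for Lipschitz $f$ we write $J(d_xf;F,G)=J(d_xf;F_x,G_{f(x)})$, which is defined for almost every $x$. Let $\mathcal{H}^m$ be the $m$-dimensional Hausdorff measure, normalized to be Lebesgue measure on $\mathbb{R}^m$. For a set $S\subset\mathbb{R}^n$, $T_yS$ denotes the $m$-dimensional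 approximate tangent space: if $S$ is $\mathcal{H}^m$-measurable and $\mathcal{H}^m\llcorner S$ is locally finite, it is the $m$-plane $P$ with $\lim_{r\downarrow0}r^{-m}\int_S\varphi((z-y)/r)\,d\mathcal{H}^m(z)=\int_P\varphi\,d\mathcal{H}^m$ for all $\varphi\in C_c(\mathbb{R}^n)$; in general $y\mapsto T_yS$ is the plane field that agrees, for every $\mathcal{H}^m$-measurable $S'\subset S$ of locally finite measure, with $T_yS'$ at $\mathcal{H}^m$-almost every $y\in S'$. A unit tangent field of $S$ is a map $y\mapsto\xi_y$ such that $\xi_y\in\Lambda^mT_yS$ and $|\xi_y|=1$ for $\mathcal{H}^m$-a.e. $y\in S$. **Theorem.** Let $m\le n$, let $f:\mathbb{R}^m\to\mathbb{R}^n$ be Lipschitz, let $F$ be an $m$-density on $\mathbb{R}^m$, $G$ an $m$-density on $\mathbb{R}^n$, and let $A\subset\mathbb{R}^m$ be Lebesgue measurable. Then $f(A)$ is $\mathcal{H}^m$-measurable and has a unit tangent field, and $x\mapsto J(d_xf;F,G)$ is measurable. Let $\xi$ be a unit tangent field of $f(A)$. If $G$ is not symmetric, assume moreover that $f$ induces the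 orientation $\xi$ on $f(A)$: for $\mathcal{H}^m$-almost every $y\in f(A)$, $\xi_y$ is a positive multiple of $\Lambda^md_xf(e)$ for every $x\in A\cap f^{-1}(y)$ at which $f$ is differentiable with $d_xf$ injective. Then $y\mapsto G(y,\xi_y)$ is $\mathcal{H}^m$-measurable on $f(A)$, and, with $dG(y)=G(y,\xi_y)\,d\mathcal{H}^m(y)$ on $f(A)$ and $N(f|_A,y)=\#(A\cap f^{-1}(y))$, the following hold. (a) $N(f|_A,\cdot)$ is $G$-measurable and $$\int_AJ(d_xf;F,G)\,dF(x)=\int_{f(A)}N(f|_A,y)\,dG(y)\in[0,\infty].$$ (b) If $u:A\to[0,\infty]$ is measurable, then $y\mapsto\sum_{x\in A\cap f^{-1}(y)}u(x)$ is $G$-measurable and $$\int_Au(x)\,J(d_xf;F,G)\,dF(x)=\int_{f(A)}\Big(\sum_{x\in A\cap f^{-1}(y)}u(x)\Big)\,dG(y).$$ The same formula holds if $u:A\to\mathbb{R}$ is measurable and $u(x)J(d_xf;F,G)$ is $F$-integrable over $A$ (in particular if $u$ is $F$-integrable over $A$ and $J(d_xf;F,G)$ is bounded); then the sum converges absolutely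 for $G$-almost every $y\in f(A)$ and is a $G$-integrable function of $y$. -/

import Mathlib

open MeasureTheory Filter Topology
open scoped NNReal ENNReal

noncomputable section

namespace AreaFormula

/-- The cone `Λ^k_s V` of simple `k`-multivectors. The scalar is redundant for `1 ≤ k`; for `k = 0`
it makes every element of `Λ^0 V = ℝ` simple. -/
def IsSimple {V : Type*} [AddCommGroup V] [Module ℝ V] {k : ℕ} (ξ : ⋀[ℝ]^k V) : Prop :=
  ∃ (a : ℝ) (v : Fin k → V), ξ = a • exteriorPower.ιMulti ℝ k v

/-- `F` is a `k`-volume density on the vector space `V`. Only the values of `F` on the cone of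
simple `k`-multivectors are relevant. -/
structure IsLinearDensity {V : Type*} [AddCommGroup V] [Module ℝ V] {k : ℕ}
    (F : ⋀[ℝ]^k V → ℝ) : Prop where
  nonneg : ∀ ξ, IsSimple ξ → 0 ≤ F ξ
  eq_zero_iff : ∀ ξ, IsSimple ξ → (F ξ = 0 ↔ ξ = 0)
  homogeneous : ∀ a : ℝ, 0 ≤ a → ∀ ξ, IsSimple ξ → F (a • ξ) = a * F ξ

/-- A `k`-volume density on the manifold `V`, all of whose tangent spaces are identified with `V`:
a continuous family of `k`-volume densities on the tangent spaces, not assumed symmetric. -/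
structure Density (k : ℕ) (V : Type*) [NormedAddCommGroup V] [InnerProductSpace ℝ V]
    [FiniteDimensional ℝ V] where
  toFun : V → ⋀[ℝ]^k V → ℝ
  isLinearDensity : ∀ x, IsLinearDensity (toFun x)
  continuousOn : ContinuousOn (fun p : V × ⋀[ℝ]^k V => toFun p.1 p.2) {p | IsSimple p.2}

instance {k : ℕ} {V : Type*} [NormedAddCommGroup V] [InnerProductSpace ℝ V]
    [FiniteDimensional ℝ V] : CoeFun (Density k V) (fun _ => V → ⋀[ℝ]^k V → ℝ) :=
  ⟨Density.toFun⟩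

/-- The density is symmetric: `G(y, -ξ) = G(y, ξ)`. -/
def Density.IsSymmetric {k : ℕ} {V : Type*} [NormedAddCommGroup V] [InnerProductSpace ℝ V]
    [FiniteDimensional ℝ V] (G : Density k V) : Prop :=
  ∀ y ξ, IsSimple ξ → G y (-ξ) = G y ξ

/-- The positively oriented unit `m`-vector `e₁ ∧ ⋯ ∧ e_m` of `ℝ^m`. -/
def stdVec (m : ℕ) : ⋀[ℝ]^m (EuclideanSpace ℝ (Fin m)) :=
  exteriorPower.ιMulti ℝ m (fun i => EuclideanSpace.basisFun (Fin m) ℝ i)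

/-- The positively oriented `m`-vector `ξ` of `ℝ^m` with `F(ξ) = 1`. -/
def unitVec {m : ℕ} (F : ⋀[ℝ]^m (EuclideanSpace ℝ (Fin m)) → ℝ) :
    ⋀[ℝ]^m (EuclideanSpace ℝ (Fin m)) :=
  (F (stdVec m))⁻¹ • stdVec m

theorem isSimple_stdVec (m : ℕ) : IsSimple (stdVec m) := ⟨1, _, (one_smul ℝ _).symm⟩

theorem norm_stdVec (m : ℕ) : ‖stdVec m‖ = 1 := by
  have h : inner ℝ (stdVec m) (stdVec m) = 1 := by
    rw [stdVec, exteriorPower.inner_ιMulti_self,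
      Matrix.gram_eq_one_iff_orthonormal.mpr (EuclideanSpace.basisFun (Fin m) ℝ).orthonormal,
      Matrix.det_one]
  rw [real_inner_self_eq_norm_sq] at h
  exact (pow_eq_one_iff_of_nonneg (norm_nonneg _) two_ne_zero).1 h

theorem apply_unitVec {m : ℕ} {F : ⋀[ℝ]^m (EuclideanSpace ℝ (Fin m)) → ℝ}
    (hF : IsLinearDensity F) : F (unitVec F) = 1 := by
  have h0 : F (stdVec m) ≠ 0 := by
    rw [Ne, hF.eq_zero_iff _ (isSimple_stdVec m), ← norm_eq_zero, norm_stdVec]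
    exact one_ne_zero
  rw [unitVec, hF.homogeneous _ (inv_nonneg.2 (hF.nonneg _ (isSimple_stdVec m))) _
    (isSimple_stdVec m), inv_mul_cancel₀ h0]

/-- The jacobian `J(L; F, G) = G(Λ^m L (ξ))`, where `ξ` is positively oriented and `F(ξ) = 1`. -/
def jacobian {m : ℕ} {W : Type*} [AddCommGroup W] [Module ℝ W]
    (L : EuclideanSpace ℝ (Fin m) →ₗ[ℝ] W)
    (F : ⋀[ℝ]^m (EuclideanSpace ℝ (Fin m)) → ℝ) (G : ⋀[ℝ]^m W → ℝ) : ℝ :=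
  G (exteriorPower.map m L (unitVec F))

/-- The measure `dF = F_x(e₁ ∧ ⋯ ∧ e_m) dx` on `ℝ^m` of a top degree density. -/
def Density.measure {m : ℕ} (F : Density m (EuclideanSpace ℝ (Fin m))) :
    Measure (EuclideanSpace ℝ (Fin m)) :=
  volume.withDensity (fun x => ENNReal.ofReal (F x (stdVec m)))

section Tangent

variable {V : Type*} [NormedAddCommGroup V] [InnerProductSpace ℝ V] [FiniteDimensional ℝ V]
  [MeasurableSpace V] [BorelSpace V]

/-- `P` is the `m`-dimensional approximate tangent space at `y` of the set `S` (which should have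
locally finite `m`-dimensional Hausdorff measure): the blow-ups `(S - y) / r` converge to `P` as
`r ↓ 0`, when tested against continuous functions with compact support. Here `μHE[m]` is the
`m`-dimensional Hausdorff measure normalized to agree with Lebesgue measure on `ℝ^m`. -/
def IsApproxTangentSpace (m : ℕ) (S : Set V) (y : V) (P : Submodule ℝ V) : Prop :=
  Module.finrank ℝ P = m ∧
    ∀ φ : V → ℝ, Continuous φ → HasCompactSupport φ →
      Tendsto (fun r : ℝ => (r ^ m)⁻¹ * ∫ z in S, φ (r⁻¹ • (z - y)) ∂μHE[m]) (𝓝[>] 0)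
        (𝓝 (∫ z in (P : Set V), φ z ∂μHE[m]))

/-- `ξ` selects at almost every point `y` of `S` one of the two unit `m`-vectors of `Λ^m T_y S`.
As `S` need not have locally finite measure, `T_y S` is understood as usual for a countable union
of sets of finite measure: it is almost everywhere the approximate tangent space of every
measurable subset of `S` with locally finite measure. -/
def IsUnitTangentField (m : ℕ) (S : Set V) (ξ : V → ⋀[ℝ]^m V) : Prop :=
  ∀ S' ⊆ S, NullMeasurableSet S' (μHE[m] : Measure V) →
    (∀ K : Set V, IsCompact K → (μHE[m] : Measure V) (S' ∩ K) < ∞) →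
    ∀ᵐ y ∂((μHE[m] : Measure V).restrict S'), ‖ξ y‖ = 1 ∧
      ∃ P : Submodule ℝ V, IsApproxTangentSpace m S' y P ∧
        ξ y ∈ LinearMap.range (exteriorPower.map m P.subtype)

/-- The measure `dG = G(y, ξ_y) dH^m(y)` on `S`. -/
def Density.measureOn {m : ℕ} (G : Density m V) (S : Set V) (ξ : V → ⋀[ℝ]^m V) : Measure V :=
  ((μHE[m] : Measure V).restrict S).withDensity (fun y => ENNReal.ofReal (G y (ξ y)))

/-- `ξ` is the orientation of `f(A)` induced by `f`: at almost every point `y` of `f(A)`, it is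
a positive multiple of `Λ^m d_x f (e₁ ∧ ⋯ ∧ e_m)` for every `x ∈ A` over `y` at which `d_x f` is
injective. -/
def IsInducedOrientation {m : ℕ} (f : EuclideanSpace ℝ (Fin m) → V)
    (A : Set (EuclideanSpace ℝ (Fin m))) (ξ : V → ⋀[ℝ]^m V) : Prop :=
  ∀ᵐ y ∂((μHE[m] : Measure V).restrict (f '' A)), ∀ x ∈ A ∩ f ⁻¹' {y},
    DifferentiableAt ℝ f x → Function.Injective (fderiv ℝ f x) →
      SameRay ℝ (ξ y)
        (exteriorPower.map m (fderiv ℝ f x : EuclideanSpace ℝ (Fin m) →ₗ[ℝ] V) (stdVec m))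

end Tangent

end AreaFormula

end

/-! Let e be the standard unit m-vector. A linear map L multiplies m-dimensional Hausdorff measure
by its Jacobian, which is also the norm of Λ^m L(e). Where f is differentiable with injective
differential, it is uniformly close to linear on countably many Borel pieces, on which it is
bi-Lipschitz and measure is distorted as by the linear model, up to a factor near 1. Summing over
the pieces and letting the factor tend to 1 gives the area formula on sets where f is injective
(`euclideanHausdorffMeasure_image_eq_lintegral`). All other points have null image, by Rademacher's
theorem and a Sard type estimate. Adding up injective pieces gives the formula with sums over fibres
(`measurable_fiberSum_and_lintegral`).

Densities enter through tangent planes. At a Lebesgue point of the Jacobian, blowing up the image of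
a piece yields the range of the differential; Besicovitch's density theorem removes the influence of
the rest of the set (`ae_isApproxTangentSpace`). Approximate tangent spaces are unique, so for
almost every y and every regular x over y, the m-vector ξ_y is a multiple of Λ^m d_xf(e), with
coefficient ±1/jac. Symmetry of G makes the sign irrelevant, and an induced orientation makes it
positive. Hence G(y, ξ_y) · jac(d_xf) = G(y, Λ^m d_xf(e)) (`ae_density_mul_jac`).

Applying the fibre formula with weight u · G(f(x), Λ^m d_xf(e)) / jac then gives the theorem for
nonnegative u. The factor F(x, e) in the measure cancels the normalization in the jacobian. Signed u
are split into positive and negative parts. -/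

noncomputable section

namespace AreaFormula

/-! ### The m-vector of a linear map and its Jacobian -/

section LinearAlgebra

variable {m : ℕ} {V : Type*} [NormedAddCommGroup V] [InnerProductSpace ℝ V]

local notation "𝔼" => EuclideanSpace ℝ (Fin m)

/-- The image `Λ^m L (e)` of the standard unit `m`-vector under a linear map `L`. -/
def pushVec (L : EuclideanSpace ℝ (Fin m) →L[ℝ] V) : ⋀[ℝ]^m V :=
  exteriorPower.map m L.toLinearMap (stdVec m)

/-- The `m`-dimensional Jacobian of a linear map on `ℝ^m`. -/
abbrev jac (L : EuclideanSpace ℝ (Fin m) →L[ℝ] V) : ℝ := L.toLinearMap.normDet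

theorem pushVec_eq (L : 𝔼 →L[ℝ] V) :
    pushVec L = exteriorPower.ιMulti ℝ m (fun i => L (EuclideanSpace.basisFun (Fin m) ℝ i)) := by
  rw [pushVec, stdVec, exteriorPower.map_apply_ιMulti]
  rfl

theorem isSimple_pushVec (L : 𝔼 →L[ℝ] V) : IsSimple (pushVec L) :=
  ⟨1, _, by rw [pushVec_eq, one_smul]⟩

theorem IsSimple.smul {k : ℕ} {ξ : ⋀[ℝ]^k V} (h : IsSimple ξ) (a : ℝ) : IsSimple (a • ξ) := by
  obtain ⟨b, v, rfl⟩ := h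
  exact ⟨a * b, v, by rw [smul_smul]⟩

theorem jac_sq_eq_det_gram (L : 𝔼 →L[ℝ] V) :
    jac L ^ 2 = (Matrix.gram ℝ (fun i => L (EuclideanSpace.basisFun (Fin m) ℝ i))).det := by
  simpa using L.toLinearMap.normDet_sq_eq_det_gram (EuclideanSpace.basisFun (Fin m) ℝ)

theorem jac_nonneg (L : 𝔼 →L[ℝ] V) : 0 ≤ jac L := L.toLinearMap.normDet_nonneg

theorem jac_pos_iff {L : 𝔼 →L[ℝ] V} : 0 < jac L ↔ Function.Injective L := by
  rw [lt_iff_le_and_ne, and_iff_right (jac_nonneg L), ne_comm]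
  exact L.toLinearMap.normDet_ne_zero_tfae.out 0 4

theorem continuous_jac : Continuous (jac : (𝔼 →L[ℝ] V) → ℝ) := by
  have h : (jac : (𝔼 →L[ℝ] V) → ℝ) = fun L => √(Matrix.gram ℝ
      (fun i => L (EuclideanSpace.basisFun (Fin m) ℝ i))).det := by
    funext L
    rw [← jac_sq_eq_det_gram, Real.sqrt_sq (jac_nonneg L)]
  rw [h]
  refine Real.continuous_sqrt.comp (Continuous.matrix_det ?_)
  refine continuous_matrix fun i j => ?_
  simp only [Matrix.gram_apply]
  fun_prop

/-- Every `m`-vector of the range of a linear map on `ℝ^m` is a multiple of the image of `e`. -/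
theorem exists_eq_smul_pushVec {L : 𝔼 →L[ℝ] V} {ξ : ⋀[ℝ]^m V}
    (h : ξ ∈ LinearMap.range (exteriorPower.map m L.range.subtype)) :
    ∃ a : ℝ, ξ = a • pushVec L := by
  obtain ⟨η, rfl⟩ := h
  have hs : Function.Surjective (exteriorPower.map m L.toLinearMap.rangeRestrict) :=
    exteriorPower.map_surjective L.toLinearMap.surjective_rangeRestrict
  obtain ⟨ζ, rfl⟩ := hs η
  have h1 : Module.finrank ℝ (⋀[ℝ]^m 𝔼) = 1 := by
    rw [exteriorPower.finrank_eq]; simp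
  have h2 : stdVec m ≠ 0 := by
    rw [← norm_ne_zero_iff, norm_stdVec]; exact one_ne_zero
  obtain ⟨a, rfl⟩ := (finrank_eq_one_iff_of_nonzero' _ h2).1 h1 ζ
  refine ⟨a, ?_⟩
  rw [map_smul, map_smul, ← LinearMap.comp_apply, ← exteriorPower.map_comp]
  rfl

theorem pushVec_mem_range (L : 𝔼 →L[ℝ] V) :
    pushVec L ∈ LinearMap.range (exteriorPower.map m L.range.subtype) := by
  refine ⟨exteriorPower.map m L.toLinearMap.rangeRestrict (stdVec m), ?_⟩
  rw [← LinearMap.comp_apply, ← exteriorPower.map_comp]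
  rfl

variable [FiniteDimensional ℝ V]

theorem norm_pushVec (L : 𝔼 →L[ℝ] V) : ‖pushVec L‖ = jac L := by
  rw [← sq_eq_sq₀ (norm_nonneg _) (jac_nonneg L), jac_sq_eq_det_gram,
    ← real_inner_self_eq_norm_sq, pushVec_eq, exteriorPower.inner_ιMulti_self]

theorem pushVec_eq_zero_iff {L : 𝔼 →L[ℝ] V} : pushVec L = 0 ↔ ¬ Function.Injective L := by
  rw [← jac_pos_iff, ← norm_pushVec, norm_pos_iff, not_not]

/-- In the orthonormal basis of Λ^k V induced from one of V, the coordinates of a wedge product are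
determinants of inner products, hence continuous. -/
theorem continuous_ιMulti {k : ℕ} :
    Continuous (fun v : Fin k → V => exteriorPower.ιMulti ℝ k v) := by
  let b := (stdOrthonormalBasis ℝ V).exteriorPower (n := k)
  have h : (fun v : Fin k → V => exteriorPower.ιMulti ℝ k v) =
      fun v => ∑ s, inner ℝ (b s) (exteriorPower.ιMulti ℝ k v) • b s := by
    funext v
    exact (b.sum_repr' _).symm
  rw [h]
  refine continuous_finsetSum _ fun s _ => ?_
  suffices hc : Continuous fun v : Fin k → V => inner ℝ (b s) (exteriorPower.ιMulti ℝ k v) from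
    hc.smul continuous_const
  have hb : b s = exteriorPower.ιMulti ℝ k
      (fun i => stdOrthonormalBasis ℝ V (Set.powersetCard.ofFinEmbEquiv.symm s i)) := by
    rw [← OrthonormalBasis.coe_toBasis, OrthonormalBasis.toBasis_exteriorPower,
      exteriorPower.coe_basis, OrthonormalBasis.coe_toBasis]
    rfl
  rw [hb]
  simp_rw [exteriorPower.inner_ιMulti_ιMulti]
  refine Continuous.matrix_det (continuous_matrix fun i j => ?_)
  simp only [Matrix.of_apply]
  fun_prop

theorem continuous_pushVec : Continuous (pushVec : (𝔼 →L[ℝ] V) → ⋀[ℝ]^m V) := by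
  have h : (pushVec : (𝔼 →L[ℝ] V) → ⋀[ℝ]^m V) = (fun v => exteriorPower.ιMulti ℝ m v) ∘
      fun L i => L (EuclideanSpace.basisFun (Fin m) ℝ i) := funext pushVec_eq
  rw [h]
  exact continuous_ιMulti.comp (by fun_prop)

end LinearAlgebra

/-! ### Comparison of Hausdorff measures of two images -/

section Hausdorff

/-- If distances of values of `f` on `s` are at most `C` times those of values of `g`, then the
Hausdorff measure of the images satisfies the corresponding inequality. -/
theorem euclideanHausdorffMeasure_image_le_of_edist_le {X Y Z : Type*} [MetricSpace Y]
    [MeasurableSpace Y] [BorelSpace Y] [MetricSpace Z] [MeasurableSpace Z] [BorelSpace Z]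
    {f : X → Y} {g : X → Z} {s : Set X} {C : ℝ≥0}
    (h : ∀ x ∈ s, ∀ y ∈ s, dist (f x) (f y) ≤ C * dist (g x) (g y)) (d : ℕ) :
    μHE[d] (f '' s) ≤ (C : ℝ≥0∞) ^ d * μHE[d] (g '' s) := by
  rcases s.eq_empty_or_nonempty with rfl | ⟨x₀, hx₀⟩
  · simp
  have : Nonempty X := ⟨x₀⟩
  -- The hypothesis forces f to be constant on the fibres of g in s, so f factors through g by a
  -- Lipschitz map k on `g '' s`, even if g is not injective.
  let k : Z → Y := fun z => f (Function.invFunOn g s z)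
  have hk : ∀ x ∈ s, k (g x) = f x := by
    intro x hx
    have h1 : Function.invFunOn g s (g x) ∈ s := Function.invFunOn_mem ⟨x, hx, rfl⟩
    have h2 : g (Function.invFunOn g s (g x)) = g x := Function.invFunOn_eq ⟨x, hx, rfl⟩
    have h3 := h _ h1 _ hx
    rw [h2, dist_self, mul_zero] at h3
    exact dist_le_zero.1 h3
  have himg : f '' s = k '' (g '' s) := by
    rw [Set.image_image]
    exact (Set.image_congr hk).symm
  have hlip : LipschitzOnWith C k (g '' s) := by
    refine LipschitzOnWith.of_dist_le_mul ?_
    rintro _ ⟨x, hx, rfl⟩ _ ⟨y, hy, rfl⟩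
    rw [hk x hx, hk y hy]
    exact h x hx y hy
  rw [himg, Measure.euclideanHausdorffMeasure_def, Measure.euclideanHausdorffMeasure_def,
    Measure.smul_apply, Measure.smul_apply, mul_smul_comm]
  rw [ENNReal.smul_def, ENNReal.smul_def, smul_eq_mul, smul_eq_mul]
  gcongr
  simpa using hlip.hausdorffMeasure_image_le (d := (d : ℝ)) (Nat.cast_nonneg d)

end Hausdorff

/-! ### Volume distortion of maps close to a linear map -/

section LocalEstimates

variable {m : ℕ} {V : Type*} [NormedAddCommGroup V] [InnerProductSpace ℝ V]

local notation "𝔼" => EuclideanSpace ℝ (Fin m)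

/-- The `m`-dimensional Jacobian of a linear map as an extended nonnegative real. -/
abbrev ejac (L : EuclideanSpace ℝ (Fin m) →L[ℝ] V) : ℝ≥0∞ := ENNReal.ofReal (jac L)

omit [InnerProductSpace ℝ V] in
theorem _root_.LipschitzWith.euclideanHausdorffMeasure_image_le_volume [MeasurableSpace V] [BorelSpace V]
    {f : 𝔼 → V} {C : ℝ≥0} (hf : LipschitzWith C f) (s : Set 𝔼) :
    μHE[m] (f '' s) ≤ (C : ℝ≥0∞) ^ m * volume s := by
  have := euclideanHausdorffMeasure_image_le_of_edist_le (f := f) (g := id) (s := s)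
    (fun x _ y _ => hf.dist_le_mul x y) m
  rwa [Set.image_id, EuclideanSpace.euclideanHausdorffMeasure_eq_volume] at this

theorem euclideanHausdorffMeasure_image_linear [MeasurableSpace V] [BorelSpace V]
    (L : 𝔼 →L[ℝ] V) (s : Set 𝔼) : μHE[m] (L '' s) = ejac L * volume s := by
  have h := L.toLinearMap.euclideanHausdorffMeasure_image_eq_normDet_mul_volume s
  rwa [finrank_euclideanSpace_fin] at h

theorem exists_forall_norm_sub_le_ejac_le_mul {A : 𝔼 →L[ℝ] V} (hA : Function.Injective A) {t : ℝ≥0}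
    (ht : 1 < t) : ∃ δ : ℝ≥0, 0 < δ ∧ ∀ B : 𝔼 →L[ℝ] V, ‖B - A‖ ≤ δ →
      ejac B ≤ t * ejac A ∧ ejac A ≤ t * ejac B := by
  have hpos := jac_pos_iff.2 hA
  have ht' : (1 : ℝ) < t := by exact_mod_cast ht
  have h1 : ∀ᶠ B in 𝓝 A, jac B < t * jac A :=
    continuous_jac.continuousAt.eventually_lt continuousAt_const (by nlinarith)
  have h2 : ∀ᶠ B in 𝓝 A, jac A < t * jac B :=
    continuousAt_const.eventually_lt (continuous_const.mul continuous_jac).continuousAt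
      (by nlinarith)
  obtain ⟨ε, hε, h⟩ := Metric.eventually_nhds_iff_ball.1 (h1.and h2)
  refine ⟨(ε / 2).toNNReal, Real.toNNReal_pos.2 (half_pos hε), fun B hB => ?_⟩
  rw [Real.coe_toNNReal _ (half_pos hε).le] at hB
  have hB' : B ∈ Metric.ball A ε := by
    rw [Metric.mem_ball, dist_eq_norm]
    exact hB.trans_lt (half_lt_self hε)
  obtain ⟨ha, hb⟩ := h B hB'
  have hto : (t : ℝ≥0∞) = ENNReal.ofReal t := by simp
  rw [hto, ejac, ejac, ← ENNReal.ofReal_mul t.coe_nonneg,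
    ← ENNReal.ofReal_mul t.coe_nonneg]
  exact ⟨ENNReal.ofReal_le_ofReal ha.le, ENNReal.ofReal_le_ofReal hb.le⟩

/-- If A is antilipschitz with constant K, an error δ‖x - y‖ is at most δK‖A(x - y)‖. So distances
under f and under A agree up to the factors 1 + δK and (1 - δK)⁻¹, and δ is taken so small that the
m-th powers of both are below t. -/
theorem exists_approximatesLinearOn_bounds [MeasurableSpace V] [BorelSpace V]
    {A : 𝔼 →L[ℝ] V} (hA : Function.Injective A) {t : ℝ≥0} (ht : 1 < t) :
    ∃ δ : ℝ≥0, 0 < δ ∧ ∃ K : ℝ≥0, ∀ (f : 𝔼 → V) (s : Set 𝔼), ApproximatesLinearOn f A s δ →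
      (∀ x ∈ s, ∀ y ∈ s, dist x y ≤ K * dist (f x) (f y)) ∧
      μHE[m] (f '' s) ≤ t * (ejac A * volume s) ∧
      ejac A * volume s ≤ t * μHE[m] (f '' s) := by
  obtain ⟨K, -, hK⟩ := A.toLinearMap.exists_antilipschitzWith (LinearMap.ker_eq_bot.2 hA)
  have hK' : ∀ v, ‖v‖ ≤ K * ‖A v‖ := fun v => by
    simpa [dist_eq_norm] using hK.le_mul_dist v 0
  have c1 : ContinuousAt (fun δ : ℝ≥0 => (1 + δ * K) ^ m) 0 := by fun_prop
  have c2 : ContinuousAt (fun δ : ℝ≥0 => (1 - δ * K)) 0 := by fun_prop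
  have c3 : ContinuousAt (fun δ : ℝ≥0 => ((1 - δ * K)⁻¹) ^ m) 0 :=
    (c2.inv₀ (by simp)).pow m
  have h1 : ∀ᶠ δ in 𝓝 (0 : ℝ≥0), (1 + δ * K) ^ m < t :=
    c1.eventually_lt continuousAt_const (by simpa using ht)
  have h2 : ∀ᶠ δ in 𝓝 (0 : ℝ≥0), ((1 - δ * K)⁻¹) ^ m < t :=
    c3.eventually_lt continuousAt_const (by simpa using ht)
  have h3 : ∀ᶠ δ in 𝓝 (0 : ℝ≥0), 0 < 1 - δ * K :=
    continuousAt_const.eventually_lt c2 (by simp)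
  have h4 : ∀ᶠ δ in 𝓝[>] (0 : ℝ≥0), 0 < δ := self_mem_nhdsWithin
  obtain ⟨δ, ⟨⟨ha, hb⟩, hc⟩, hδ⟩ :=
    ((((h1.and h2).and h3).filter_mono nhdsWithin_le_nhds).and h4).exists
  refine ⟨δ, hδ, (1 - δ * K)⁻¹ * K, fun f s hf => ?_⟩
  have hδK : ((1 - δ * K : ℝ≥0) : ℝ) = 1 - δ * K := by
    rw [NNReal.coe_sub (tsub_pos_iff_lt.1 hc).le]; simp
  have hc' : (0 : ℝ) < 1 - δ * K := by rw [← hδK]; exact_mod_cast hc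
  have hsub : ∀ x y, A x - A y = A (x - y) := fun x y => (map_sub A x y).symm
  have up : ∀ x ∈ s, ∀ y ∈ s, dist (f x) (f y) ≤ (1 + δ * K : ℝ≥0) * dist (A x) (A y) := by
    intro x hx y hy
    rw [dist_eq_norm, dist_eq_norm, hsub]
    have e1 := hf x hx y hy
    have e2 := hK' (x - y)
    have e3 := norm_sub_norm_le (f x - f y) (A (x - y))
    have e4 : (δ : ℝ) * ‖x - y‖ ≤ δ * (K * ‖A (x - y)‖) := by gcongr
    push_cast
    linarith
  have lo : ∀ x ∈ s, ∀ y ∈ s,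
      dist (A x) (A y) ≤ ((1 - δ * K)⁻¹ : ℝ≥0) * dist (f x) (f y) := by
    intro x hx y hy
    rw [dist_eq_norm, dist_eq_norm, hsub, NNReal.coe_inv, hδK, le_inv_mul_iff₀ hc']
    have e1 := hf x hx y hy
    have e2 := hK' (x - y)
    have e3 := norm_sub_norm_le (A (x - y)) (f x - f y)
    rw [norm_sub_rev (A (x - y))] at e3
    have e4 : (δ : ℝ) * ‖x - y‖ ≤ δ * (K * ‖A (x - y)‖) := by gcongr
    linarith
  refine ⟨fun x hx y hy => ?_, ?_, ?_⟩
  · have e1 := lo x hx y hy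
    have e2 : dist x y ≤ K * dist (A x) (A y) := hK.le_mul_dist x y
    calc dist x y ≤ K * dist (A x) (A y) := e2
      _ ≤ K * (((1 - δ * K)⁻¹ : ℝ≥0) * dist (f x) (f y)) := by gcongr
      _ = _ := by push_cast; ring
  · have := euclideanHausdorffMeasure_image_le_of_edist_le up m
    rw [euclideanHausdorffMeasure_image_linear] at this
    refine this.trans ?_
    gcongr
    exact_mod_cast ha.le
  · have := euclideanHausdorffMeasure_image_le_of_edist_le lo m
    rw [euclideanHausdorffMeasure_image_linear] at this
    refine this.trans ?_
    gcongr
    exact_mod_cast hb.le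

/-- A map that is close to a degenerate linear map contracts volume by a large factor. -/
theorem exists_approximatesLinearOn_bound_of_not_injective [MeasurableSpace V] [BorelSpace V]
    [FiniteDimensional ℝ V]
    {A : 𝔼 →L[ℝ] V} (hA : ¬ Function.Injective A) {η : ℝ≥0} (hη : 0 < η) :
    ∃ δ : ℝ≥0, 0 < δ ∧ ∀ (f : 𝔼 → V) (s : Set 𝔼), ApproximatesLinearOn f A s δ →
      μHE[m] (f '' s) ≤ η * volume s := by
  -- The degenerate A is perturbed to the injective map x ↦ (A x, εx) into V × ℝ^m. Its Jacobian
  -- tends to 0 with ε, so the injective estimate applies with a small constant. The same lift of f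
  -- projects back to f without increasing distances.
  let e := (WithLp.prodContinuousLinearEquiv 2 ℝ V 𝔼).symm
  let B : ℝ → 𝔼 →L[ℝ] WithLp 2 (V × 𝔼) := fun ε =>
    e.toContinuousLinearMap.comp (A.prod (ε • ContinuousLinearMap.id ℝ 𝔼))
  have hBapp : ∀ ε x, B ε x = WithLp.toLp 2 (A x, ε • x) := fun ε x => rfl
  have hcont : Continuous B := by
    have h1 : B = fun ε => e.toContinuousLinearMap.comp
        ((ContinuousLinearMap.inl ℝ V 𝔼).comp A + ε • ContinuousLinearMap.inr ℝ V 𝔼) := by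
      funext ε
      ext x : 1
      rw [ContinuousLinearMap.comp_apply, ContinuousLinearMap.comp_apply]
      refine congrArg _ (Prod.ext ?_ ?_) <;> simp
    rw [h1]
    fun_prop
  have h0 : jac (B 0) = 0 := by
    by_contra h
    refine hA ?_
    have := jac_pos_iff.1 ((jac_nonneg _).lt_of_ne' h)
    intro x y hxy
    refine this ?_
    rw [hBapp, hBapp, hxy, zero_smul, zero_smul]
  have h1 : ∀ᶠ ε in 𝓝 (0 : ℝ), jac (B ε) < η / 2 :=
    (continuous_jac.comp hcont).continuousAt.eventually_lt continuousAt_const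
      (by simp only [Function.comp, h0]; positivity)
  have h2 : ∀ᶠ ε in 𝓝[>] (0 : ℝ), 0 < ε := self_mem_nhdsWithin
  obtain ⟨ε, hε, hε0⟩ := ((h1.filter_mono nhdsWithin_le_nhds).and h2).exists
  have hinj : Function.Injective (B ε) := by
    intro x y hxy
    rw [hBapp, hBapp] at hxy
    have := congrArg (fun p => (WithLp.ofLp p).2) hxy
    exact smul_right_injective _ hε0.ne' this
  obtain ⟨δ, hδ, K, h⟩ := exists_approximatesLinearOn_bounds hinj (t := 2) one_lt_two
  refine ⟨δ, hδ, fun f s hf => ?_⟩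
  let F : 𝔼 → WithLp 2 (V × 𝔼) := fun x => WithLp.toLp 2 (f x, ε • x)
  have hF : ApproximatesLinearOn F (B ε) s δ := by
    intro x hx y hy
    have : F x - F y - B ε (x - y) = WithLp.toLp 2 (f x - f y - A (x - y), 0) := by
      rw [hBapp, ← WithLp.toLp_sub, ← WithLp.toLp_sub]
      simp [smul_sub]
    rw [this, WithLp.prod_norm_eq_of_L2]
    simpa using hf x hx y hy
  have hle : ∀ x ∈ s, ∀ y ∈ s, dist (f x) (f y) ≤ (1 : ℝ≥0) * dist (F x) (F y) := by
    intro x _ y _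
    rw [NNReal.coe_one, one_mul, dist_eq_norm, dist_eq_norm, ← WithLp.toLp_sub,
      WithLp.prod_norm_eq_of_L2]
    refine Real.le_sqrt_of_sq_le ?_
    exact le_add_of_nonneg_right (by positivity)
  have h3 := euclideanHausdorffMeasure_image_le_of_edist_le hle m
  rw [ENNReal.coe_one, one_pow, one_mul] at h3
  refine h3.trans ((h F s hF).2.1.trans ?_)
  rw [← mul_assoc]
  gcongr
  calc ((2 : ℝ≥0) : ℝ≥0∞) * ejac (B ε) ≤ ((2 : ℝ≥0) : ℝ≥0∞) * ENNReal.ofReal (η / 2) :=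
      mul_le_mul_right (ENNReal.ofReal_le_ofReal hε.le) _
    _ = ENNReal.ofReal (2 * (η / 2)) := by
      rw [ENNReal.ofReal_mul (by norm_num)]; norm_num
    _ = η := by rw [mul_div_cancel₀ _ two_ne_zero]; simp

/-- A measurable set of points of differentiability is a countable disjoint union of measurable
sets on each of which `f` is close to a linear map and `fderiv ℝ f` is close to the same map. -/
theorem exists_partition_approximatesLinearOn_fderiv [FiniteDimensional ℝ V] (f : 𝔼 → V)
    {D : Set 𝔼} (hDm : MeasurableSet D) (hD : ∀ x ∈ D, DifferentiableAt ℝ f x)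
    (r : (𝔼 →L[ℝ] V) → ℝ≥0) (hr : ∀ L, 0 < r L) :
    ∃ (t : ℕ → Set 𝔼) (A : ℕ → 𝔼 →L[ℝ] V), Pairwise (Function.onFun Disjoint t) ∧
      (∀ n, MeasurableSet (t n)) ∧ (⋃ n, t n) = D ∧
      (∀ n, ApproximatesLinearOn f (A n) (t n) (r (A n))) ∧
      (∀ n, ∀ x ∈ t n, ‖fderiv ℝ f x - A n‖ ≤ r (A n)) ∧
      (D.Nonempty → ∀ n, ∃ y ∈ D, A n = fderiv ℝ f y) := by
  rcases D.eq_empty_or_nonempty with rfl | hne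
  · exact ⟨fun _ => ∅, fun _ => 0, by simp [Pairwise, Function.onFun], by simp, by simp, by simp,
      by simp, by simp⟩
  -- The tolerance is shared: half for the distance from the model φ k to nearby differentials, half
  -- for the approximation of f by such a differential. Together they bound the distance of f from
  -- the model itself.
  have hr2 : ∀ L, 0 < r L / 2 := fun L => half_pos (hr L)
  obtain ⟨T, hTs, hTc, hT⟩ := TopologicalSpace.countable_cover_nhdsWithin
    (s := fderiv ℝ f '' D) (f := fun L => Metric.ball L (r L / 2 : ℝ≥0))
    (fun L _ => mem_nhdsWithin_of_mem_nhds (Metric.ball_mem_nhds L (by exact_mod_cast hr2 L)))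
  have hTne : T.Nonempty := by
    obtain ⟨x, hx⟩ := hne
    obtain ⟨L, hL, -⟩ := Set.mem_iUnion₂.1 (hT ⟨x, hx, rfl⟩)
    exact ⟨L, hL⟩
  obtain ⟨φ, rfl⟩ := hTc.exists_eq_range hTne
  let Dk : ℕ → Set 𝔼 := fun k => D ∩ fderiv ℝ f ⁻¹' Metric.ball (φ k) (r (φ k) / 2 : ℝ≥0)
  have hDk : ∀ k, MeasurableSet (Dk k) := fun k =>
    hDm.inter (measurable_fderiv ℝ f Metric.isOpen_ball.measurableSet)
  have hpart : ∀ k, ∃ (t : ℕ → Set 𝔼) (A : ℕ → 𝔼 →L[ℝ] V), (∀ n, IsClosed (t n)) ∧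
      (Dk k ⊆ ⋃ n, t n) ∧ (∀ n, ApproximatesLinearOn f (A n) (Dk k ∩ t n) (r (φ k) / 2)) ∧
      ((Dk k).Nonempty → ∀ n, ∃ y ∈ Dk k, A n = fderiv ℝ f y) := fun k =>
    exists_closed_cover_approximatesLinearOn_of_hasFDerivWithinAt f (Dk k) (fderiv ℝ f)
      (fun x hx => (hD x hx.1).hasFDerivAt.hasFDerivWithinAt) (fun _ => r (φ k) / 2)
      (fun _ => (hr2 _).ne')
  choose t A htc htD htA htn using hpart
  let u : ℕ → Set 𝔼 := fun j => Dk j.unpair.1 ∩ t j.unpair.1 j.unpair.2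
  have hum : ∀ j, MeasurableSet (u j) := fun j => (hDk _).inter (htc _ _).measurableSet
  have huD : (⋃ j, u j) = D := by
    apply Set.Subset.antisymm
    · exact Set.iUnion_subset fun j x hx => hx.1.1
    · intro x hx
      obtain ⟨_, ⟨k, rfl⟩, hxk⟩ := Set.mem_iUnion₂.1 (hT ⟨x, hx, rfl⟩)
      have hxD : x ∈ Dk k := ⟨hx, hxk⟩
      obtain ⟨n, hn⟩ := Set.mem_iUnion.1 (htD k hxD)
      refine Set.mem_iUnion.2 ⟨Nat.pair k n, ?_⟩
      simp only [u, Nat.unpair_pair]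
      exact ⟨hxD, hn⟩
  refine ⟨disjointed u, fun j => φ j.unpair.1, disjoint_disjointed u,
    MeasurableSet.disjointed hum, by rw [iUnion_disjointed, huD], fun j => ?_, fun j x hx => ?_,
    fun _ j => ?_⟩
  · refine ApproximatesLinearOn.mono_set (disjointed_subset u j) ?_
    intro x hx y hy
    obtain ⟨z, hz, hAz⟩ := htn j.unpair.1 ⟨x, hx.1⟩ j.unpair.2
    have e1 := htA j.unpair.1 j.unpair.2 x hx y hy
    have e2 : ‖A j.unpair.1 j.unpair.2 - φ j.unpair.1‖ ≤ (r (φ j.unpair.1) / 2 : ℝ≥0) := by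
      rw [hAz, ← dist_eq_norm]
      exact (Metric.mem_ball.1 hz.2).le
    have e3 := (A j.unpair.1 j.unpair.2 - φ j.unpair.1).le_of_opNorm_le e2 (x - y)
    have e4 : f x - f y - φ j.unpair.1 (x - y) =
        (f x - f y - A j.unpair.1 j.unpair.2 (x - y)) +
          (A j.unpair.1 j.unpair.2 - φ j.unpair.1) (x - y) := by
      simp
    rw [e4]
    refine (norm_add_le _ _).trans ((add_le_add e1 e3).trans (le_of_eq ?_))
    push_cast
    ring
  · have := (disjointed_subset u j hx).1.2
    rw [Set.mem_preimage, Metric.mem_ball, dist_eq_norm] at this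
    refine this.le.trans ?_
    push_cast
    exact half_le_self (NNReal.coe_nonneg _)
  · obtain ⟨y, hy, h⟩ := hTs ⟨j.unpair.1, rfl⟩
    exact ⟨y, hy, h.symm⟩

end LocalEstimates

/-- Let t decrease to 1. Multiplication by b passes to the limit even for b = ∞, since the limiting
coefficient is not 0. -/
theorem le_of_forall_one_lt_le_sq_mul {a b : ℝ≥0∞}
    (h : ∀ t : ℝ≥0, 1 < t → a ≤ (t * t : ℝ≥0) * b) : a ≤ b := by
  have h1 : Tendsto (fun t : ℝ≥0 => ((t * t : ℝ≥0) : ℝ≥0∞) * b) (𝓝[>] 1)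
      (𝓝 (((1 * 1 : ℝ≥0) : ℝ≥0∞) * b)) := by
    refine ENNReal.Tendsto.mul_const (ENNReal.tendsto_coe.2 ?_) (Or.inl (by simp))
    exact ((continuous_id.mul continuous_id).tendsto (1 : ℝ≥0)).mono_left nhdsWithin_le_nhds
  rw [mul_one, ENNReal.coe_one, one_mul] at h1
  exact ge_of_tendsto h1 (eventually_mem_nhdsWithin.mono fun t ht => h t ht)

/-! ### Area formula for injective maps; null image of the non-regular points -/

section Area

variable {m : ℕ} {V : Type*} [NormedAddCommGroup V] [InnerProductSpace ℝ V]

local notation "𝔼" => EuclideanSpace ℝ (Fin m)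

/-- The set of points at which `f` is differentiable with injective differential. -/
def regularSet (f : EuclideanSpace ℝ (Fin m) → V) : Set (EuclideanSpace ℝ (Fin m)) :=
  {x | DifferentiableAt ℝ f x ∧ Function.Injective (fderiv ℝ f x)}

variable [FiniteDimensional ℝ V]

theorem measurable_jac_fderiv (f : 𝔼 → V) : Measurable fun x => jac (fderiv ℝ f x) :=
  continuous_jac.measurable.comp (measurable_fderiv ℝ f)

theorem measurable_ejac_fderiv (f : 𝔼 → V) : Measurable fun x => ejac (fderiv ℝ f x) :=
  ENNReal.measurable_ofReal.comp (measurable_jac_fderiv f)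

theorem measurableSet_regularSet (f : 𝔼 → V) : MeasurableSet (regularSet f) := by
  have h : regularSet f = {x | DifferentiableAt ℝ f x} ∩ {x | 0 < jac (fderiv ℝ f x)} := by
    ext x
    simp only [regularSet, jac_pos_iff, Set.mem_ofPred_eq, Set.mem_inter_iff]
  rw [h]
  exact (measurableSet_of_differentiableAt ℝ f).inter
    (measurableSet_lt measurable_const (measurable_jac_fderiv f))

omit [FiniteDimensional ℝ V] in
theorem continuousOn_of_subset_regularSet {f : 𝔼 → V} {s : Set 𝔼} (hs : s ⊆ regularSet f) :
    ContinuousOn f s := fun _ hx => (hs hx).1.continuousAt.continuousWithinAt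

variable [MeasurableSpace V] [BorelSpace V]

omit [FiniteDimensional ℝ V] in
-- Lusin–Souslin: a continuous injective image of a Borel set is Borel.
theorem measurableSet_image_of_subset_regularSet {f : 𝔼 → V} {s : Set 𝔼} (hsm : MeasurableSet s)
    (hs : s ⊆ regularSet f) (hinj : Set.InjOn f s) : MeasurableSet (f '' s) :=
  hsm.image_of_continuousOn_injOn (continuousOn_of_subset_regularSet hs) hinj

/-- The regular set is a countable disjoint union of measurable pieces on which `f` is
antilipschitz, `fderiv ℝ f` has a nearly constant Jacobian, and the area formula holds up to a
factor close to one. -/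
theorem exists_partition_regularSet (f : 𝔼 → V) {t : ℝ≥0} (ht : 1 < t) :
    ∃ (P : ℕ → Set 𝔼) (A : ℕ → 𝔼 →L[ℝ] V), Pairwise (Function.onFun Disjoint P) ∧
      (∀ n, MeasurableSet (P n)) ∧ (⋃ n, P n) = regularSet f ∧
      (∀ n, ∃ K : ℝ≥0, ∀ x ∈ P n, ∀ y ∈ P n, dist x y ≤ K * dist (f x) (f y)) ∧
      (∀ n, ∀ s ⊆ P n, μHE[m] (f '' s) ≤ t * (ejac (A n) * volume s) ∧
        ejac (A n) * volume s ≤ t * μHE[m] (f '' s)) ∧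
      (∀ n, ∀ x ∈ P n, ejac (fderiv ℝ f x) ≤ t * ejac (A n) ∧
        ejac (A n) ≤ t * ejac (fderiv ℝ f x)) := by
  have H : ∀ A : 𝔼 →L[ℝ] V, ∃ δ : ℝ≥0, 0 < δ ∧ (Function.Injective A →
      (∃ K : ℝ≥0, ∀ (s : Set 𝔼), ApproximatesLinearOn f A s δ →
      (∀ x ∈ s, ∀ y ∈ s, dist x y ≤ K * dist (f x) (f y)) ∧
      μHE[m] (f '' s) ≤ t * (ejac A * volume s) ∧
      ejac A * volume s ≤ t * μHE[m] (f '' s)) ∧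
      ∀ B : 𝔼 →L[ℝ] V, ‖B - A‖ ≤ δ → ejac B ≤ t * ejac A ∧ ejac A ≤ t * ejac B) := by
    intro A
    by_cases hA : Function.Injective A
    · obtain ⟨δ, hδ, K, h⟩ := exists_approximatesLinearOn_bounds hA ht
      obtain ⟨δ', hδ', h'⟩ := exists_forall_norm_sub_le_ejac_le_mul hA ht
      refine ⟨min δ δ', lt_min hδ hδ', fun _ => ⟨⟨K, fun s hs => ?_⟩, fun B hB => ?_⟩⟩
      · exact h f s (hs.mono_num (min_le_left _ _))
      · exact h' B (hB.trans (by exact_mod_cast min_le_right _ _))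
    -- A dummy tolerance: the models of nonempty pieces are differentials at regular points, hence
    -- injective.
    · exact ⟨1, one_pos, fun h => absurd h hA⟩
  choose δ hδ hP using H
  obtain ⟨P, A, hdisj, hm, hU, happ, hder, hA⟩ := exists_partition_approximatesLinearOn_fderiv f
    (measurableSet_regularSet f) (fun x hx => hx.1) δ hδ
  have hinj : ∀ n, (P n).Nonempty → Function.Injective (A n) := by
    rintro n ⟨x, hx⟩
    have hxr : x ∈ regularSet f := hU ▸ Set.mem_iUnion.2 ⟨n, hx⟩
    obtain ⟨y, hy, h⟩ := hA ⟨x, hxr⟩ n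
    rw [h]
    exact hy.2
  refine ⟨P, A, hdisj, hm, hU, fun n => ?_, fun n s hs => ?_, fun n x hx => ?_⟩
  · rcases (P n).eq_empty_or_nonempty with h | h
    · exact ⟨0, by simp [h]⟩
    · obtain ⟨K, hK⟩ := (hP _ (hinj n h)).1
      exact ⟨K, (hK _ (happ n)).1⟩
  · rcases (P n).eq_empty_or_nonempty with h | h
    · have : s = ∅ := Set.subset_eq_empty hs h
      simp [this]
    · obtain ⟨K, hK⟩ := (hP _ (hinj n h)).1
      exact (hK _ ((happ n).mono_set hs)).2
  · exact (hP _ (hinj n ⟨x, hx⟩)).2 _ (hder n x hx)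

/-- **Area formula** for the image of a set on which `f` is injective. -/
theorem euclideanHausdorffMeasure_image_eq_lintegral {f : 𝔼 → V} {s : Set 𝔼}
    (hsm : MeasurableSet s) (hs : s ⊆ regularSet f) (hinj : Set.InjOn f s) :
    μHE[m] (f '' s) = ∫⁻ x in s, ejac (fderiv ℝ f x) := by
  -- One factor t compares the measure of the image with the linear model, the other compares the
  -- Jacobian of f with that of the model.
  have key : ∀ t : ℝ≥0, 1 < t →
      μHE[m] (f '' s) ≤ (t * t : ℝ≥0) * ∫⁻ x in s, ejac (fderiv ℝ f x) ∧
      ∫⁻ x in s, ejac (fderiv ℝ f x) ≤ (t * t : ℝ≥0) * μHE[m] (f '' s) := by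
    intro t ht
    obtain ⟨P, A, hdisj, hm, hU, -, hvol, hder⟩ := exists_partition_regularSet f ht
    have hsU : s = ⋃ n, s ∩ P n := by
      rw [← Set.inter_iUnion, hU, Set.inter_eq_self_of_subset_left hs]
    have hsm' : ∀ n, MeasurableSet (s ∩ P n) := fun n => hsm.inter (hm n)
    have hd' : Pairwise (Function.onFun Disjoint fun n => s ∩ P n) := fun i j hij =>
      (hdisj hij).mono Set.inter_subset_right Set.inter_subset_right
    have hH : μHE[m] (f '' s) = ∑' n, μHE[m] (f '' (s ∩ P n)) := by
      conv_lhs => rw [hsU, Set.image_iUnion]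
      refine measure_iUnion (fun i j hij => ?_) fun n =>
        measurableSet_image_of_subset_regularSet (hsm' n) (Set.inter_subset_left.trans hs)
          (hinj.mono Set.inter_subset_left)
      exact (hd' hij).image hinj Set.inter_subset_left Set.inter_subset_left
    have hI : ∫⁻ x in s, ejac (fderiv ℝ f x) = ∑' n, ∫⁻ x in s ∩ P n, ejac (fderiv ℝ f x) := by
      conv_lhs => rw [hsU]
      exact lintegral_iUnion hsm' hd' _
    rw [hH, hI, ← ENNReal.tsum_mul_left, ← ENNReal.tsum_mul_left]
    have hc : ∀ n, ∫⁻ _ in s ∩ P n, ejac (A n) = ejac (A n) * volume (s ∩ P n) := fun n => by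
      rw [lintegral_const, Measure.restrict_apply_univ]
    constructor
    · refine ENNReal.tsum_le_tsum fun n => ?_
      calc μHE[m] (f '' (s ∩ P n)) ≤ t * (ejac (A n) * volume (s ∩ P n)) :=
            (hvol n _ Set.inter_subset_right).1
        _ = t * ∫⁻ _ in s ∩ P n, ejac (A n) := by rw [hc]
        _ ≤ t * ∫⁻ x in s ∩ P n, t * ejac (fderiv ℝ f x) := by
          exact mul_le_mul' le_rfl (setLIntegral_mono' (hsm' n) fun x hx => (hder n x hx.2).2)
        _ = (t * t : ℝ≥0) * ∫⁻ x in s ∩ P n, ejac (fderiv ℝ f x) := by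
          rw [lintegral_const_mul _ (measurable_ejac_fderiv f), ENNReal.coe_mul, mul_assoc]
    · refine ENNReal.tsum_le_tsum fun n => ?_
      calc ∫⁻ x in s ∩ P n, ejac (fderiv ℝ f x) ≤ ∫⁻ _ in s ∩ P n, t * ejac (A n) :=
            setLIntegral_mono' (hsm' n) fun x hx => (hder n x hx.2).1
        _ = t * (ejac (A n) * volume (s ∩ P n)) := by
          rw [lintegral_const, Measure.restrict_apply_univ, mul_assoc]
        _ ≤ t * (t * μHE[m] (f '' (s ∩ P n))) := by
          exact mul_le_mul' le_rfl (hvol n _ Set.inter_subset_right).2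
        _ = (t * t : ℝ≥0) * μHE[m] (f '' (s ∩ P n)) := by rw [ENNReal.coe_mul, mul_assoc]
  exact le_antisymm (le_of_forall_one_lt_le_sq_mul fun t ht => (key t ht).1)
    (le_of_forall_one_lt_le_sq_mul fun t ht => (key t ht).2)

/-- A **Sard** type lemma: the image of the set where the differential is not injective is null. -/
theorem euclideanHausdorffMeasure_image_critical {f : 𝔼 → V} {s : Set 𝔼}
    (hd : ∀ x ∈ s, DifferentiableAt ℝ f x) (hs : ∀ x ∈ s, ¬ Function.Injective (fderiv ℝ f x)) :
    μHE[m] (f '' s) = 0 := by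
  let Z : Set 𝔼 := {x | DifferentiableAt ℝ f x} \ regularSet f
  have hZm : MeasurableSet Z :=
    (measurableSet_of_differentiableAt ℝ f).diff (measurableSet_regularSet f)
  have hsZ : s ⊆ Z := fun x hx => ⟨hd x hx, fun h => hs x hx h.2⟩
  refine measure_mono_null (Set.image_mono hsZ) ?_
  -- Bounded parts have finite volume, so that the bound η · volume tends to 0 with η.
  have hball : ∀ R : ℕ, μHE[m] (f '' (Z ∩ Metric.closedBall 0 R)) = 0 := by
    intro R
    let B := Z ∩ Metric.closedBall (0 : 𝔼) R
    have hBm : MeasurableSet B := hZm.inter measurableSet_closedBall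
    have hBfin : volume B ≠ ∞ :=
      ((measure_mono Set.inter_subset_right).trans_lt measure_closedBall_lt_top).ne
    have key : ∀ η : ℝ≥0, 0 < η → μHE[m] (f '' B) ≤ η * volume B := by
      intro η hη
      have H : ∀ A : 𝔼 →L[ℝ] V, ∃ δ : ℝ≥0, 0 < δ ∧ (¬ Function.Injective A → ∀ (s : Set 𝔼),
          ApproximatesLinearOn f A s δ → μHE[m] (f '' s) ≤ η * volume s) := by
        intro A
        by_cases hA : Function.Injective A
        · exact ⟨1, one_pos, fun h => absurd hA h⟩
        · obtain ⟨δ, hδ, h⟩ := exists_approximatesLinearOn_bound_of_not_injective hA hη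
          exact ⟨δ, hδ, fun _ => h f⟩
      choose δ hδ hP using H
      obtain ⟨P, A, hdisj, hm, hU, happ, -, hA⟩ := exists_partition_approximatesLinearOn_fderiv f
        hBm (fun x hx => hx.1.1) δ hδ
      have hb : ∀ n, μHE[m] (f '' P n) ≤ η * volume (P n) := by
        intro n
        rcases (P n).eq_empty_or_nonempty with h | ⟨x, hx⟩
        · simp [h]
        · obtain ⟨y, hy, h⟩ := hA ⟨x, hU ▸ Set.mem_iUnion.2 ⟨n, hx⟩⟩ n
          exact hP _ (fun hi => hy.1.2 ⟨hy.1.1, h ▸ hi⟩) _ (happ n)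
      rw [← hU, Set.image_iUnion, measure_iUnion hdisj hm, ← ENNReal.tsum_mul_left]
      exact (measure_iUnion_le _).trans (ENNReal.tsum_le_tsum hb)
    have hlim : Tendsto (fun η : ℝ≥0 => (η : ℝ≥0∞) * volume B) (𝓝[>] 0)
        (𝓝 (((0 : ℝ≥0) : ℝ≥0∞) * volume B)) :=
      (ENNReal.Tendsto.mul_const (ENNReal.tendsto_coe.2 tendsto_id)
        (Or.inr hBfin)).mono_left nhdsWithin_le_nhds
    rw [ENNReal.coe_zero, zero_mul] at hlim
    exact le_antisymm (ge_of_tendsto hlim (eventually_mem_nhdsWithin.mono key)) zero_le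
  have hZU : Z = ⋃ R : ℕ, Z ∩ Metric.closedBall 0 R := (Metric.iUnion_inter_closedBall_nat Z 0).symm
  rw [hZU, Set.image_iUnion, measure_iUnion_null_iff]
  exact hball

theorem euclideanHausdorffMeasure_image_diff_regularSet {f : 𝔼 → V} {C : ℝ≥0}
    (hf : LipschitzWith C f) : μHE[m] (f '' (regularSet f)ᶜ) = 0 := by
  have h : (regularSet f)ᶜ ⊆ {x | ¬ DifferentiableAt ℝ f x} ∪
      {x | DifferentiableAt ℝ f x ∧ ¬ Function.Injective (fderiv ℝ f x)} := by
    intro x hx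
    by_cases hd : DifferentiableAt ℝ f x
    · exact Or.inr ⟨hd, fun hi => hx ⟨hd, hi⟩⟩
    · exact Or.inl hd
  refine measure_mono_null (Set.image_mono h) ?_
  rw [Set.image_union, measure_union_null_iff]
  refine ⟨le_antisymm ((hf.euclideanHausdorffMeasure_image_le_volume _).trans ?_) zero_le,
    euclideanHausdorffMeasure_image_critical (fun x hx => hx.1) fun x hx => hx.2⟩
  have h0 : volume {x | ¬ DifferentiableAt ℝ f x} = 0 := hf.ae_differentiableAt
  rw [h0, mul_zero]

end Area

/-! ### Area formula with sums over fibres -/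

section Fiber

variable {m : ℕ} {V : Type*} [NormedAddCommGroup V] [InnerProductSpace ℝ V]
  [FiniteDimensional ℝ V] [MeasurableSpace V] [BorelSpace V]

local notation "𝔼" => EuclideanSpace ℝ (Fin m)

/-- **Area formula** as an equality of measures, on a set on which `f` is injective. -/
theorem map_withDensity_ejac_restrict {f : 𝔼 → V} (hf : Measurable f) {s : Set 𝔼}
    (hsm : MeasurableSet s) (hs : s ⊆ regularSet f) (hinj : Set.InjOn f s) :
    ((volume.restrict s).withDensity fun x => ejac (fderiv ℝ f x)).map f =
      (μHE[m] : Measure V).restrict (f '' s) := by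
  ext t ht
  rw [Measure.map_apply hf ht, withDensity_apply _ (hf ht), Measure.restrict_restrict (hf ht),
    Measure.restrict_apply ht, Set.inter_comm, Set.inter_comm t, ← Set.image_inter_preimage f s t,
    euclideanHausdorffMeasure_image_eq_lintegral (hsm.inter (hf ht))
      (Set.inter_subset_left.trans hs) (hinj.mono Set.inter_subset_left)]

theorem setLIntegral_image {f : 𝔼 → V} (hf : Measurable f) {s : Set 𝔼}
    (hsm : MeasurableSet s) (hs : s ⊆ regularSet f) (hinj : Set.InjOn f s)
    {g : V → ℝ≥0∞} (hg : Measurable g) :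
    ∫⁻ y in f '' s, g y ∂μHE[m] = ∫⁻ x in s, g (f x) * ejac (fderiv ℝ f x) := by
  rw [← map_withDensity_ejac_restrict hf hsm hs hinj, lintegral_map hg hf,
    lintegral_withDensity_eq_lintegral_mul _ (measurable_ejac_fderiv f)
      (g := fun x => g (f x)) (hg.comp hf)]
  simp only [Pi.mul_apply, mul_comm]

/-- Sum of `g` over the points of `s` in the fiber of `f` over `y`. -/
def fiberSum {X Y : Type*} (f : X → Y) (s : Set X) (g : X → ℝ≥0∞) (y : Y) : ℝ≥0∞ :=
  ∑' x : ↥(s ∩ f ⁻¹' {y}), g x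

/-- Written as an extension by zero along f, the fibre sum inherits measurability from a measurable
embedding. -/
theorem fiberSum_of_injOn {X Y : Type*} {f : X → Y} {s : Set X} (hinj : Set.InjOn f s)
    (g : X → ℝ≥0∞) :
    fiberSum f s g = Function.extend (s.domRestrict f) (fun x : s => g x) 0 := by
  funext y
  by_cases hy : ∃ x : s, s.domRestrict f x = y
  · obtain ⟨x, rfl⟩ := hy
    rw [hinj.injective.extend_apply]
    have h : s ∩ f ⁻¹' {s.domRestrict f x} = {(x : X)} := by
      ext z
      constructor
      · rintro ⟨hz, hfz⟩
        exact hinj hz x.2 hfz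
      · rintro rfl
        exact ⟨x.2, rfl⟩
    rw [fiberSum, h, tsum_singleton (x : X) g]
  · rw [Function.extend_apply' _ _ _ hy]
    have h : s ∩ f ⁻¹' {y} = ∅ := by
      rw [Set.eq_empty_iff_forall_notMem]
      exact fun x hx => hy ⟨⟨x, hx.1⟩, hx.2⟩
    rw [fiberSum, h]
    simp

theorem fiberSum_iUnion {X Y : Type*} (f : X → Y) {P : ℕ → Set X}
    (hP : Pairwise (Function.onFun Disjoint P)) (g : X → ℝ≥0∞) (y : Y) :
    fiberSum f (⋃ n, P n) g y = ∑' n, fiberSum f (P n) g y := by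
  have h : (⋃ n, P n) ∩ f ⁻¹' {y} = ⋃ n, P n ∩ f ⁻¹' {y} := by
    rw [Set.iUnion_inter]
  rw [fiberSum, h, ENNReal.tsum_biUnion]
  · rfl
  · exact fun i _ j _ hij => (hP hij).mono Set.inter_subset_left Set.inter_subset_left

theorem fiberSum_eq_zero {X Y : Type*} {f : X → Y} {s : Set X} {g : X → ℝ≥0∞} {y : Y}
    (hy : y ∉ f '' s) : fiberSum f s g y = 0 := by
  have h : s ∩ f ⁻¹' {y} = ∅ := by
    rw [Set.eq_empty_iff_forall_notMem]
    exact fun x hx => hy ⟨x, hx.1, hx.2⟩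
  rw [fiberSum, h]
  simp

theorem exists_partition_injOn (f : 𝔼 → V) {S : Set 𝔼} (hSm : MeasurableSet S)
    (hS : S ⊆ regularSet f) :
    ∃ P : ℕ → Set 𝔼, Pairwise (Function.onFun Disjoint P) ∧ (∀ n, MeasurableSet (P n)) ∧
      (⋃ n, P n) = S ∧
      ∀ n, ∃ K : ℝ≥0, ∀ x ∈ P n, ∀ y ∈ P n, dist x y ≤ K * dist (f x) (f y) := by
  -- Any t > 1 serves, as only the antilipschitz bounds are kept.
  obtain ⟨P, -, hdisj, hm, hU, hK, -⟩ := exists_partition_regularSet f (t := 2) one_lt_two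
  refine ⟨fun n => S ∩ P n, fun i j hij => (hdisj hij).mono Set.inter_subset_right
    Set.inter_subset_right, fun n => hSm.inter (hm n), ?_, fun n => ?_⟩
  · rw [← Set.inter_iUnion, hU, Set.inter_eq_self_of_subset_left hS]
  · obtain ⟨K, h⟩ := hK n
    exact ⟨K, fun x hx y hy => h x hx.2 y hy.2⟩

theorem injOn_of_dist_le {X Y : Type*} [MetricSpace X] [PseudoMetricSpace Y] {f : X → Y}
    {s : Set X} {K : ℝ≥0} (h : ∀ x ∈ s, ∀ y ∈ s, dist x y ≤ K * dist (f x) (f y)) :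
    Set.InjOn f s := fun x hx y hy hxy => by
  have := h x hx y hy
  rw [hxy, dist_self, mul_zero] at this
  exact dist_le_zero.1 this

/-- On a piece where f is injective this is the change of variables for y ↦ g(f⁻¹(y)). Fibre sums
are countably additive over disjoint pieces, and sums of nonnegative functions commute with the
integral. -/
theorem measurable_fiberSum_and_lintegral {f : 𝔼 → V} (hf : Measurable f) {S : Set 𝔼}
    (hSm : MeasurableSet S) (hS : S ⊆ regularSet f) {g : 𝔼 → ℝ≥0∞} (hg : Measurable g) :
    Measurable (fiberSum f S g) ∧
      ∫⁻ y, fiberSum f S g y ∂μHE[m] = ∫⁻ x in S, g x * ejac (fderiv ℝ f x) := by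
  obtain ⟨P, hdisj, hm, hU, hK⟩ := exists_partition_injOn f hSm hS
  have hinj : ∀ n, Set.InjOn f (P n) := fun n => injOn_of_dist_le (hK n).choose_spec
  have hPr : ∀ n, P n ⊆ regularSet f := fun n =>
    (Set.subset_iUnion P n).trans (hU.le.trans hS)
  have hmeas : ∀ n, Measurable (fiberSum f (P n) g) := by
    intro n
    rw [fiberSum_of_injOn (hinj n)]
    have hemb : MeasurableEmbedding ((P n).domRestrict f) :=
      (continuousOn_of_subset_regularSet (hPr n)).measurableEmbedding (hm n) (hinj n)
    exact hemb.measurable_extend (hg.comp measurable_subtype_coe) measurable_const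
  have hint : ∀ n, ∫⁻ y, fiberSum f (P n) g y ∂μHE[m] =
      ∫⁻ x in P n, g x * ejac (fderiv ℝ f x) := by
    intro n
    have hsupp : Function.support (fiberSum f (P n) g) ⊆ f '' P n := by
      intro y hy
      by_contra h
      exact hy (fiberSum_eq_zero h)
    rw [← setLIntegral_eq_of_support_subset hsupp,
      setLIntegral_image hf (hm n) (hPr n) (hinj n) (hmeas n)]
    refine setLIntegral_congr_fun (hm n) fun x hx => ?_
    have : fiberSum f (P n) g (f x) = g x := by
      rw [fiberSum_of_injOn (hinj n)]
      exact (hinj n).injective.extend_apply _ _ (⟨x, hx⟩ : P n)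
    simp only [this]
  have hsum : fiberSum f S g = fun y => ∑' n, fiberSum f (P n) g y := by
    funext y
    rw [← hU, fiberSum_iUnion f hdisj]
  rw [hsum]
  refine ⟨Measurable.tsum hmeas, ?_⟩
  rw [lintegral_tsum fun n => (hmeas n).aemeasurable, ← hU, lintegral_iUnion hm hdisj]
  exact tsum_congr hint

end Fiber

/-! ### Uniqueness of approximate tangent spaces; blow-ups of bi-Lipschitz images -/

section ApproxTangent

variable {m : ℕ} {V : Type*} [NormedAddCommGroup V] [InnerProductSpace ℝ V]
  [FiniteDimensional ℝ V] [MeasurableSpace V] [BorelSpace V]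

local notation "𝔼" => EuclideanSpace ℝ (Fin m)

theorem setIntegral_submodule_eq {P : Submodule ℝ V} (hP : Module.finrank ℝ P = m) (φ : V → ℝ) :
    ∫ z in (P : Set V), φ z ∂μHE[m] = ∫ p : P, φ p := by
  have hemb : MeasurableEmbedding (Subtype.val : P → V) :=
    MeasurableEmbedding.subtype_coe P.closed_of_finiteDimensional.measurableSet
  have h := (isometry_subtype_coe (s := (P : Set V))).map_euclideanHausdorffMeasure (d := m)
  rw [Subtype.range_coe] at h
  rw [← h]
  have h2 : (μHE[m] : Measure P) = volume := by
    rw [← hP]; exact InnerProductSpace.euclideanHausdorffMeasure_eq_volume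
  rw [← h2]
  exact hemb.integral_map φ

/-- If p lies in P but not in Q, a bump function equal to 1 at p and vanishing on Q has positive
integral over P and zero integral over Q, though both are limits of the same blow-ups. -/
theorem IsApproxTangentSpace.le {S : Set V} {y : V} {P Q : Submodule ℝ V}
    (hP : IsApproxTangentSpace m S y P) (hQ : IsApproxTangentSpace m S y Q) : P ≤ Q := by
  intro p hp
  by_contra hpQ
  have hQc : IsClosed (Q : Set V) := Q.closed_of_finiteDimensional
  obtain ⟨φ, hφ1, hφ0, hφc, hφ⟩ := exists_continuous_one_zero_of_isCompact
    (isCompact_singleton (x := p)) hQc (Set.disjoint_singleton_left.2 hpQ)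
  have h := tendsto_nhds_unique (hP.2 φ φ.continuous hφc) (hQ.2 φ φ.continuous hφc)
  rw [setIntegral_submodule_eq hP.1, setIntegral_submodule_eq hQ.1] at h
  have hQ0 : ∫ q : Q, φ q = 0 :=
    (integral_congr_ae (Eventually.of_forall fun q => hφ0 q.2)).trans (by simp)
  have hP0 : 0 < ∫ q : P, φ q := by
    refine Continuous.integral_pos_of_hasCompactSupport_nonneg_nonzero (x := ⟨p, hp⟩)
      (φ.continuous.comp continuous_subtype_val)
      (hφc.comp_isClosedEmbedding P.closed_of_finiteDimensional.isClosedEmbedding_subtypeVal)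
      (fun q => (hφ q).1) ?_
    have h1 : φ p = 1 := hφ1 rfl
    simp [h1]
  exact hP0.ne' (h.trans hQ0)

theorem IsApproxTangentSpace.unique {S : Set V} {y : V} {P Q : Submodule ℝ V}
    (hP : IsApproxTangentSpace m S y P) (hQ : IsApproxTangentSpace m S y Q) : P = Q :=
  le_antisymm (hP.le hQ) (hQ.le hP)

theorem setIntegral_image_eq {f : 𝔼 → V} (hf : Measurable f) {s : Set 𝔼}
    (hsm : MeasurableSet s) (hs : s ⊆ regularSet f) (hinj : Set.InjOn f s) {ψ : V → ℝ}
    (hψ : Continuous ψ) :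
    ∫ y in f '' s, ψ y ∂μHE[m] = ∫ x, s.indicator (fun x => jac (fderiv ℝ f x)) x * ψ (f x) := by
  rw [← map_withDensity_ejac_restrict hf hsm hs hinj, integral_map hf.aemeasurable
    hψ.aestronglyMeasurable, integral_withDensity_eq_integral_toReal_smul
    (measurable_ejac_fderiv f) (by simp), ← integral_indicator hsm]
  refine integral_congr_ae (Eventually.of_forall fun x => ?_)
  by_cases hx : x ∈ s
  · simp [hx, ENNReal.toReal_ofReal (jac_nonneg _)]
  · simp [hx]

theorem setIntegral_range_eq {L : 𝔼 →L[ℝ] V} (hL : Function.Injective L) {ψ : V → ℝ}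
    (hψ : Continuous ψ) :
    ∫ y in (L.range : Set V), ψ y ∂μHE[m] = jac L * ∫ x, ψ (L x) := by
  have h := setIntegral_image_eq (f := L) L.continuous.measurable MeasurableSet.univ
    (fun x _ => ⟨L.differentiableAt, by rw [L.fderiv]; exact hL⟩) hL.injOn hψ
  have hr : (L.range : Set V) = L '' Set.univ := by rw [Set.image_univ]; rfl
  rw [hr, h, ← integral_const_mul]
  simp

/-- By the injective area formula, the integral over a ball is the Hausdorff measure of an image,
which is finite because f is Lipschitz. -/
theorem locallyIntegrable_indicator_jac {f : 𝔼 → V} {C : ℝ≥0} (hf : LipschitzWith C f)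
    {s : Set 𝔼} (hsm : MeasurableSet s) (hs : s ⊆ regularSet f) (hinj : Set.InjOn f s) :
    LocallyIntegrable (s.indicator fun x => jac (fderiv ℝ f x)) := by
  intro x
  refine ⟨Metric.closedBall x 1, Metric.closedBall_mem_nhds x one_pos,
    ((measurable_jac_fderiv f).indicator hsm).aestronglyMeasurable, ?_⟩
  rw [hasFiniteIntegral_iff_enorm]
  have h1 : ∀ z, ‖s.indicator (fun x => jac (fderiv ℝ f x)) z‖ₑ =
      s.indicator (fun x => ejac (fderiv ℝ f x)) z := by
    intro z
    by_cases hz : z ∈ s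
    · simp [hz, Real.enorm_of_nonneg (jac_nonneg _)]
    · simp [hz]
  simp_rw [h1]
  rw [lintegral_indicator hsm, Measure.restrict_restrict hsm,
    ← euclideanHausdorffMeasure_image_eq_lintegral (hsm.inter measurableSet_closedBall)
      (Set.inter_subset_left.trans hs) (hinj.mono Set.inter_subset_left)]
  refine (hf.euclideanHausdorffMeasure_image_le_volume _).trans_lt (ENNReal.mul_lt_top
    (ENNReal.pow_lt_top ENNReal.coe_lt_top) ?_)
  exact (measure_mono Set.inter_subset_right).trans_lt measure_closedBall_lt_top

theorem inv_pow_mul_setIntegral_closedBall (F : 𝔼 → ℝ) (x : 𝔼) {r : ℝ} (hr : 0 < r) (R : ℝ) :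
    (r ^ m)⁻¹ * ∫ z in Metric.closedBall x (R * r), F z =
      ∫ h in Metric.closedBall (0 : 𝔼) R, F (x + r • h) := by
  rw [← integral_indicator measurableSet_closedBall, ← integral_indicator measurableSet_closedBall,
    ← integral_add_left_eq_self _ x]
  have h := Measure.integral_comp_smul (volume : Measure 𝔼)
    (fun z => (Metric.closedBall x (R * r)).indicator F (x + z)) r
  rw [finrank_euclideanSpace_fin, abs_of_pos (inv_pos.2 (pow_pos hr m)), smul_eq_mul] at h
  rw [← h]
  refine integral_congr_ae (Eventually.of_forall fun z => ?_)
  have hiff : x + r • z ∈ Metric.closedBall x (R * r) ↔ z ∈ Metric.closedBall (0 : 𝔼) R := by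
    rw [Metric.mem_closedBall, Metric.mem_closedBall, dist_self_add_left, dist_zero_right,
      norm_smul, Real.norm_of_nonneg hr.le, mul_comm R, mul_le_mul_iff_right₀ hr]
  by_cases hz : z ∈ Metric.closedBall (0 : 𝔼) R
  · simp only [Set.indicator_of_mem hz, Set.indicator_of_mem (hiff.2 hz)]
  · simp only [Set.indicator_of_notMem hz, Set.indicator_of_notMem (fun h => hz (hiff.1 h))]

omit [FiniteDimensional ℝ V] [MeasurableSpace V] [BorelSpace V] in
-- Difference quotients converge to directional derivatives; dominated convergence applies on the
-- bounded ball.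
theorem tendsto_integral_blowup {f : 𝔼 → V} {C : ℝ≥0} (hf : LipschitzWith C f) {x : 𝔼}
    (hx : DifferentiableAt ℝ f x) {φ : V → ℝ} (hφ : Continuous φ) {M : ℝ} (hM : ∀ z, ‖φ z‖ ≤ M)
    (R : ℝ) :
    Tendsto (fun r : ℝ => ∫ h in Metric.closedBall (0 : 𝔼) R, φ (r⁻¹ • (f (x + r • h) - f x)))
      (𝓝[>] 0) (𝓝 (∫ h in Metric.closedBall (0 : 𝔼) R, φ (fderiv ℝ f x h))) := by
  refine tendsto_integral_filter_of_dominated_convergence (fun _ => M) ?_ ?_ ?_ ?_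
  · refine Eventually.of_forall fun r => Continuous.aestronglyMeasurable ?_
    have := hf.continuous
    fun_prop
  · exact Eventually.of_forall fun r => Eventually.of_forall fun h => hM _
  · exact integrableOn_const measure_closedBall_lt_top.ne
  · refine Eventually.of_forall fun h => (hφ.tendsto _).comp ?_
    have h1 : HasLineDerivAt ℝ f (fderiv ℝ f x h) x h := hx.hasFDerivAt.hasLineDerivAt h
    exact h1.tendsto_slope_zero_right

/-- Pull the integral back to ℝ^m, where the weight g is the Jacobian on s and 0 elsewhere. At a
Lebesgue point, g may be replaced by its value at x, and the rescaled integrand then converges to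
that of the linear map. -/
theorem ae_tendsto_blowup_image {f : 𝔼 → V} {C : ℝ≥0} (hf : LipschitzWith C f) {s : Set 𝔼}
    (hsm : MeasurableSet s) (hs : s ⊆ regularSet f) {K : ℝ≥0}
    (hK : ∀ x ∈ s, ∀ y ∈ s, dist x y ≤ K * dist (f x) (f y)) :
    ∀ᵐ x, x ∈ s → ∀ φ : V → ℝ, Continuous φ → HasCompactSupport φ →
      Tendsto (fun r : ℝ => (r ^ m)⁻¹ * ∫ z in f '' s, φ (r⁻¹ • (z - f x)) ∂μHE[m]) (𝓝[>] 0)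
        (𝓝 (∫ z in ((fderiv ℝ f x).range : Set V), φ z ∂μHE[m])) := by
  have hinj := injOn_of_dist_le hK
  let g : 𝔼 → ℝ := s.indicator fun x => jac (fderiv ℝ f x)
  have hg : LocallyIntegrable g := locallyIntegrable_indicator_jac hf hsm hs hinj
  filter_upwards [IsUnifLocDoublingMeasure.ae_tendsto_average_norm_sub volume hg 1]
    with x hxL hxs φ hφ hφc
  have hL := (hs hxs).2
  set L := fderiv ℝ f x
  have hgx : g x = jac L := Set.indicator_of_mem hxs _
  obtain ⟨M, hM⟩ := hφc.exists_bound_of_continuous hφ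
  obtain ⟨R₀, hR₀⟩ := hφc.isCompact.isBounded.subset_closedBall (0 : V)
  have hφ0 : ∀ z, φ z ≠ 0 → ‖z‖ ≤ max R₀ 0 := fun z hz => by
    have := hR₀ (subset_tsupport φ hz)
    rw [mem_closedBall_zero_iff] at this
    exact this.trans (le_max_left _ _)
  obtain ⟨K', -, hK'⟩ := L.toLinearMap.exists_antilipschitzWith (LinearMap.ker_eq_bot.2 hL)
  -- The support of φ pulls back into the ball of radius R r about x under the rescaled f restricted
  -- to s (constant K), and into the ball of radius R about 0 under L (constant K').
  let R : ℝ := (K + K') * max R₀ 0 + 1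
  have hRpos : 0 < R := by positivity
  have hKR : K * max R₀ 0 ≤ R := by
    have : 0 ≤ K' * max R₀ 0 := by positivity
    simp only [R]; linarith
  have hKR' : K' * max R₀ 0 ≤ R := by
    have : 0 ≤ K * max R₀ 0 := by positivity
    simp only [R]; linarith
  have hlim : ∫ z in (L.range : Set V), φ z ∂μHE[m] =
      jac L * ∫ h in Metric.closedBall (0 : 𝔼) R, φ (L h) := by
    rw [setIntegral_range_eq hL hφ]
    congr 1
    symm
    refine setIntegral_eq_integral_of_forall_compl_eq_zero fun h hh => ?_
    by_contra h0
    refine hh ?_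
    rw [mem_closedBall_zero_iff]
    have h1 := hK'.le_mul_dist h 0
    rw [dist_zero_right, map_zero, dist_zero_right] at h1
    exact (h1.trans (by gcongr; exact hφ0 _ h0)).trans hKR'
  -- Split g(z) into g(z) - g(x), an error controlled by the Lebesgue point property, and the
  -- constant g(x) = jac L, which gives the main term.
  have hleft : ∀ r : ℝ, 0 < r → (r ^ m)⁻¹ * ∫ z in f '' s, φ (r⁻¹ • (z - f x)) ∂μHE[m] =
      (r ^ m)⁻¹ * (∫ z in Metric.closedBall x (R * r), (g z - g x) * φ (r⁻¹ • (f z - f x))) +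
        jac L * ∫ h in Metric.closedBall (0 : 𝔼) R, φ (r⁻¹ • (f (x + r • h) - f x)) := by
    intro r hr
    have hcont : Continuous fun z => φ (r⁻¹ • (f z - f x)) := by
      have := hf.continuous
      fun_prop
    have hint1 : IntegrableOn g (Metric.closedBall x (R * r)) :=
      hg.integrableOn_isCompact (isCompact_closedBall _ _)
    have hI1 : IntegrableOn (fun z => (g z - g x) * φ (r⁻¹ • (f z - f x)))
        (Metric.closedBall x (R * r)) := by
      refine Integrable.mul_bdd (c := M) ?_ hcont.aestronglyMeasurable
        (Eventually.of_forall fun z => hM _)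
      exact hint1.sub (integrableOn_const measure_closedBall_lt_top.ne)
    have hI2 : IntegrableOn (fun z => g x * φ (r⁻¹ • (f z - f x)))
        (Metric.closedBall x (R * r)) :=
      (hcont.continuousOn.integrableOn_compact (isCompact_closedBall _ _)).const_mul _
    rw [setIntegral_image_eq hf.continuous.measurable hsm hs hinj
      (ψ := fun z => φ (r⁻¹ • (z - f x))) (by fun_prop),
      ← inv_pow_mul_setIntegral_closedBall (fun z => φ (r⁻¹ • (f z - f x))) x hr R, mul_left_comm,
      ← mul_add, ← hgx, ← integral_const_mul (g x), ← integral_add hI1 hI2]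
    congr 1
    rw [← setIntegral_eq_integral_of_forall_compl_eq_zero (s := Metric.closedBall x (R * r))]
    · refine integral_congr_ae (Eventually.of_forall fun z => ?_)
      simp only [g]
      ring
    · intro z hz
      by_contra h0
      have hzs : z ∈ s := by
        by_contra hzs
        exact h0 (by rw [Set.indicator_of_notMem hzs, zero_mul])
      refine hz ?_
      have h1 := hφ0 _ (right_ne_zero_of_mul h0)
      rw [norm_smul, norm_inv, Real.norm_of_nonneg hr.le, inv_mul_le_iff₀ hr,
        ← dist_eq_norm] at h1
      rw [Metric.mem_closedBall]
      calc dist z x ≤ K * dist (f z) (f x) := hK z hzs x hxs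
        _ ≤ K * (r * max R₀ 0) := by gcongr
        _ = K * max R₀ 0 * r := by ring
        _ ≤ R * r := by gcongr
  have herr : Tendsto (fun r : ℝ => (r ^ m)⁻¹ *
      ∫ z in Metric.closedBall x (R * r), (g z - g x) * φ (r⁻¹ • (f z - f x))) (𝓝[>] 0) (𝓝 0) := by
    have hδ : Tendsto (fun r : ℝ => R * r) (𝓝[>] 0) (𝓝[>] 0) := by
      refine tendsto_nhdsWithin_iff.2 ⟨?_, eventually_mem_nhdsWithin.mono fun r hr =>
        mul_pos hRpos hr⟩
      have : Tendsto (fun r : ℝ => R * r) (𝓝 0) (𝓝 (R * 0)) := by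
        exact (continuous_const.mul continuous_id).tendsto 0
      rw [mul_zero] at this
      exact this.mono_left nhdsWithin_le_nhds
    have h1 := hxL (fun _ => x) (fun r : ℝ => R * r) hδ
      (eventually_mem_nhdsWithin.mono fun r (hr : 0 < r) => by
        rw [one_mul]; exact Metric.mem_closedBall_self (mul_pos hRpos hr).le)
    have h2 := h1.const_mul (M * (R ^ m * volume.real (Metric.ball (0 : 𝔼) 1)))
    rw [mul_zero] at h2
    refine squeeze_zero_norm' (eventually_mem_nhdsWithin.mono fun r (hr : 0 < r) => ?_) h2
    have hint1 : IntegrableOn (fun z => ‖g z - g x‖) (Metric.closedBall x (R * r)) :=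
      ((hg.integrableOn_isCompact (isCompact_closedBall _ _)).sub
        (integrableOn_const measure_closedBall_lt_top.ne)).norm
    have h3 : ‖∫ z in Metric.closedBall x (R * r), (g z - g x) * φ (r⁻¹ • (f z - f x))‖ ≤
        M * ∫ z in Metric.closedBall x (R * r), ‖g z - g x‖ := by
      rw [← integral_const_mul]
      refine norm_integral_le_of_norm_le (hint1.const_mul M) (Eventually.of_forall fun z => ?_)
      rw [norm_mul, mul_comm]
      gcongr
      exact hM _
    have h4 := measure_smul_setAverage (μ := volume) (fun z => ‖g z - g x‖)
      (s := Metric.closedBall x (R * r)) measure_closedBall_lt_top.ne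
    rw [← h4, smul_eq_mul, Measure.addHaar_real_closedBall _ _ (mul_pos hRpos hr).le,
      finrank_euclideanSpace_fin] at h3
    rw [norm_mul, norm_inv, norm_pow, Real.norm_of_nonneg hr.le, inv_mul_le_iff₀ (pow_pos hr m)]
    refine h3.trans (le_of_eq ?_)
    rw [mul_pow]
    ring
  rw [hlim]
  have hsum := herr.add ((tendsto_integral_blowup hf (hs hxs).1 hφ hM R).const_mul (jac L))
  rw [zero_add] at hsum
  exact hsum.congr' (eventually_mem_nhdsWithin.mono fun r hr => (hleft r hr).symm)

end ApproxTangent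

/-! ### From a bi-Lipschitz piece to a larger set -/

section ApproxTangent

variable {m : ℕ} {V : Type*} [NormedAddCommGroup V] [InnerProductSpace ℝ V]
  [FiniteDimensional ℝ V] [MeasurableSpace V] [BorelSpace V]

local notation "𝔼" => EuclideanSpace ℝ (Fin m)

omit [InnerProductSpace ℝ V] [FiniteDimensional ℝ V] in
theorem euclideanHausdorffMeasure_image_inter_closedBall_le {f : 𝔼 → V} {C : ℝ≥0}
    (hf : LipschitzWith C f) {s : Set 𝔼} {K : ℝ≥0}
    (hK : ∀ x ∈ s, ∀ y ∈ s, dist x y ≤ K * dist (f x) (f y)) {x : 𝔼} (hx : x ∈ s) {r : ℝ}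
    (hr : 0 ≤ r) :
    μHE[m] (f '' s ∩ Metric.closedBall (f x) r) ≤
      ENNReal.ofReal (C ^ m * K ^ m * volume.real (Metric.ball (0 : 𝔼) 1) * r ^ m) := by
  have hsub : f '' s ∩ Metric.closedBall (f x) r ⊆ f '' Metric.closedBall x (K * r) := by
    rintro _ ⟨⟨z, hz, rfl⟩, hzr⟩
    refine ⟨z, ?_, rfl⟩
    rw [Metric.mem_closedBall] at hzr ⊢
    exact (hK z hz x hx).trans (by gcongr)
  refine (measure_mono hsub).trans ((hf.euclideanHausdorffMeasure_image_le_volume _).trans ?_)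
  have hKr : 0 ≤ K * r := by positivity
  rw [Measure.addHaar_closedBall _ _ hKr, finrank_euclideanSpace_fin,
    ← ENNReal.ofReal_toReal (measure_ball_lt_top (μ := volume) (x := (0 : 𝔼)) (r := 1)).ne,
    ← ENNReal.ofReal_mul (by positivity), ← ENNReal.ofReal_coe_nnreal,
    ← ENNReal.ofReal_pow C.coe_nonneg, ← ENNReal.ofReal_mul (by positivity)]
  refine ENNReal.ofReal_le_ofReal (le_of_eq ?_)
  rw [mul_pow, Measure.real]
  ring

/-- At almost every point of the intersection of `S` with a bi-Lipschitz image, the rest of `S`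
has vanishing `m`-dimensional density. -/
theorem ae_tendsto_diff_image {f : 𝔼 → V} {C : ℝ≥0} (hf : LipschitzWith C f) {s : Set 𝔼}
    {K : ℝ≥0} (hK : ∀ x ∈ s, ∀ y ∈ s, dist x y ≤ K * dist (f x) (f y))
    (hfs : MeasurableSet (f '' s)) {S : Set V} (hsS : f '' s ⊆ S)
    [IsLocallyFiniteMeasure ((μHE[m] : Measure V).restrict S)] :
    ∀ᵐ y ∂((μHE[m] : Measure V).restrict (f '' s)), y ∈ f '' s →
      Tendsto (fun r : ℝ => (r ^ m)⁻¹ *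
        ((μHE[m] : Measure V).restrict S).real (Metric.closedBall y r \ f '' s))
        (𝓝[>] 0) (𝓝 0) := by
  set μ := (μHE[m] : Measure V).restrict S with hμ
  have hμB : μ.restrict (f '' s) = (μHE[m] : Measure V).restrict (f '' s) := by
    rw [hμ, Measure.restrict_restrict hfs, Set.inter_eq_self_of_subset_left hsS]
  rw [← hμB]
  filter_upwards [Besicovitch.ae_tendsto_measure_inter_div μ (f '' s)] with y hy hys
  obtain ⟨x, hx, rfl⟩ := hys
  let q : ℝ → ℝ := fun r => (μ (f '' s ∩ Metric.closedBall (f x) r) /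
    μ (Metric.closedBall (f x) r)).toReal
  have hq : Tendsto q (𝓝[>] 0) (𝓝 1) := by
    have := (ENNReal.tendsto_toReal ENNReal.one_ne_top).comp hy
    rwa [ENNReal.toReal_one] at this
  let c : ℝ := C ^ m * K ^ m * volume.real (Metric.ball (0 : 𝔼) 1)
  have hc : 0 ≤ c := by positivity
  -- With q the fraction of the ball's measure carried by the piece, the remainder is (1 - q) times
  -- that measure. Once q > 1/2, the whole is at most twice the piece's share, which is at most c
  -- r^m.
  have hlim : Tendsto (fun r => 2 * c * (1 - q r)) (𝓝[>] 0) (𝓝 (2 * c * (1 - 1))) :=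
    (tendsto_const_nhds.sub hq).const_mul _
  rw [sub_self, mul_zero] at hlim
  have hhalf : ∀ᶠ r in 𝓝[>] (0 : ℝ), 1 / 2 < q r := hq.eventually_const_lt (by norm_num)
  refine squeeze_zero' ?_ ?_ hlim
  · exact eventually_mem_nhdsWithin.mono fun r (hr : 0 < r) =>
      mul_nonneg (inv_nonneg.2 (pow_nonneg hr.le _)) measureReal_nonneg
  · filter_upwards [hhalf, eventually_mem_nhdsWithin] with r hqr (hr : 0 < r)
    have hbfin : μ (Metric.closedBall (f x) r) ≠ ∞ :=
      (isCompact_closedBall (f x) r).measure_lt_top.ne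
    have hqr' : q r = μ.real (Metric.closedBall (f x) r ∩ f '' s) /
        μ.real (Metric.closedBall (f x) r) := by
      rw [Measure.real, Measure.real, ← ENNReal.toReal_div, Set.inter_comm]
    have hsplit := measureReal_inter_add_sdiff (μ := μ) (s := Metric.closedBall (f x) r) hfs hbfin
    have ha : μ.real (Metric.closedBall (f x) r ∩ f '' s) ≤ c * r ^ m := by
      have h1 : μ (Metric.closedBall (f x) r ∩ f '' s) ≤ ENNReal.ofReal (c * r ^ m) := by
        rw [Set.inter_comm]
        exact (Measure.restrict_apply_le _ _).trans
          (euclideanHausdorffMeasure_image_inter_closedBall_le hf hK hx hr.le)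
      exact ENNReal.toReal_le_of_le_ofReal (by positivity) h1
    set a := μ.real (Metric.closedBall (f x) r ∩ f '' s)
    set b := μ.real (Metric.closedBall (f x) r)
    set d := μ.real (Metric.closedBall (f x) r \ f '' s)
    have hb : 0 < b := by
      rcases (measureReal_nonneg : 0 ≤ b).eq_or_lt with h | h
      · exfalso
        have hb0 : b = 0 := h.symm
        rw [hqr', hb0, div_zero] at hqr
        norm_num at hqr
      · exact h
    have hab : a = q r * b := by rw [hqr', div_mul_cancel₀ _ hb.ne']
    have hq1 : q r ≤ 1 := by
      rw [hqr', div_le_one hb]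
      have : 0 ≤ d := measureReal_nonneg
      linarith
    rw [inv_mul_le_iff₀ (pow_pos hr m)]
    have hb2 : b ≤ 2 * (c * r ^ m) := by nlinarith
    have hd : d = b * (1 - q r) := by linarith
    rw [hd]
    calc b * (1 - q r) ≤ 2 * (c * r ^ m) * (1 - q r) := by gcongr
      _ = _ := by ring

omit [FiniteDimensional ℝ V] in
theorem IsApproxTangentSpace.congr_restrict {S T : Set V}
    {y : V} {P : Submodule ℝ V} (hT : IsApproxTangentSpace m T y P)
    (h : (μHE[m] : Measure V).restrict S = (μHE[m] : Measure V).restrict T) :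
    IsApproxTangentSpace m S y P := by
  refine ⟨hT.1, fun φ hφ hφc => ?_⟩
  rw [h]
  exact hT.2 φ hφ hφc

/-- The part of S outside B contributes at most sup|φ| times its measure in a ball of radius
comparable to r, which is o(r^m). -/
theorem isApproxTangentSpace_of_subset {B S : Set V} (hB : MeasurableSet B) (hBS : B ⊆ S)
    [IsLocallyFiniteMeasure ((μHE[m] : Measure V).restrict S)] {y : V} {P : Submodule ℝ V}
    (hBP : IsApproxTangentSpace m B y P)
    (h0 : Tendsto (fun r : ℝ => (r ^ m)⁻¹ *
        ((μHE[m] : Measure V).restrict S).real (Metric.closedBall y r \ B)) (𝓝[>] 0) (𝓝 0)) :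
    IsApproxTangentSpace m S y P := by
  refine ⟨hBP.1, fun φ hφ hφc => ?_⟩
  obtain ⟨M, hM⟩ := hφc.exists_bound_of_continuous hφ
  obtain ⟨R₀, hR₀⟩ := hφc.isCompact.isBounded.subset_closedBall (0 : V)
  set μ := (μHE[m] : Measure V).restrict S with hμ
  have hμB : μ.restrict B = (μHE[m] : Measure V).restrict B := by
    rw [hμ, Measure.restrict_restrict hB, Set.inter_eq_self_of_subset_left hBS]
  let R : ℝ := max R₀ 0 + 1
  have hR : 0 < R := by positivity
  have hφ0 : ∀ z, φ z ≠ 0 → ‖z‖ ≤ R := fun z hz => by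
    have := hR₀ (subset_tsupport φ hz)
    rw [mem_closedBall_zero_iff] at this
    exact this.trans ((le_max_left _ _).trans (le_add_of_nonneg_right zero_le_one))
  have hδ : Tendsto (fun r : ℝ => R * r) (𝓝[>] 0) (𝓝[>] 0) := by
    refine tendsto_nhdsWithin_iff.2 ⟨?_, eventually_mem_nhdsWithin.mono fun r hr =>
      mul_pos hR hr⟩
    have : Tendsto (fun r : ℝ => R * r) (𝓝 0) (𝓝 (R * 0)) := by
      exact (continuous_const.mul continuous_id).tendsto 0
    rw [mul_zero] at this
    exact this.mono_left nhdsWithin_le_nhds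
  have herr : Tendsto (fun r : ℝ => (r ^ m)⁻¹ * ∫ z in Bᶜ, φ (r⁻¹ • (z - y)) ∂μ)
      (𝓝[>] 0) (𝓝 0) := by
    have h1 := (h0.comp hδ).const_mul (M * R ^ m)
    rw [mul_zero] at h1
    refine squeeze_zero_norm' (eventually_mem_nhdsWithin.mono fun r (hr : 0 < r) => ?_) h1
    have hball : ∀ z, z ∉ Metric.closedBall y (R * r) → φ (r⁻¹ • (z - y)) = 0 := by
      intro z hz
      by_contra h
      refine hz ?_
      have h2 := hφ0 _ h
      rw [norm_smul, norm_inv, Real.norm_of_nonneg hr.le, inv_mul_le_iff₀ hr, ← dist_eq_norm] at h2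
      rw [Metric.mem_closedBall, mul_comm]
      exact h2
    have h3 : ∫ z in Bᶜ, φ (r⁻¹ • (z - y)) ∂μ =
        ∫ z in Metric.closedBall y (R * r) \ B, φ (r⁻¹ • (z - y)) ∂μ := by
      refine (setIntegral_eq_of_subset_of_forall_sdiff_eq_zero hB.compl (fun z hz => hz.2)
        fun z hz => hball z fun h => hz.2 ⟨h, hz.1⟩)
    have hfin : μ (Metric.closedBall y (R * r) \ B) < ∞ :=
      (measure_mono Set.sdiff_subset).trans_lt (isCompact_closedBall y (R * r)).measure_lt_top
    have h4 := norm_setIntegral_le_of_norm_le_const (f := fun z => φ (r⁻¹ • (z - y))) hfin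
      (fun z _ => hM _)
    rw [← h3] at h4
    rw [norm_mul, norm_inv, norm_pow, Real.norm_of_nonneg hr.le, inv_mul_le_iff₀ (pow_pos hr m)]
    refine h4.trans (le_of_eq ?_)
    simp only [Function.comp]
    have : r ^ m ≠ 0 := (pow_pos hr m).ne'
    have : R ^ m ≠ 0 := (pow_pos hR m).ne'
    rw [mul_pow]
    field_simp
  have hsum := (hBP.2 φ hφ hφc).add herr
  rw [add_zero] at hsum
  refine hsum.congr' (eventually_mem_nhdsWithin.mono fun r (hr : 0 < r) => ?_)
  have hint : Integrable (fun z => φ (r⁻¹ • (z - y))) μ := by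
    refine Continuous.integrable_of_hasCompactSupport (by fun_prop) ?_
    let e : V ≃ₜ V := (Homeomorph.subRight y).trans (Homeomorph.smulOfNeZero r⁻¹ (inv_ne_zero hr.ne'))
    exact hφc.comp_homeomorph e
  rw [← mul_add, ← hμB, integral_add_compl hB hint]

/-- At almost every point of `S` that lies on a bi-Lipschitz piece of the image of `f`, the
approximate tangent space of `S` is the range of the differential of `f`. -/
theorem ae_isApproxTangentSpace {f : 𝔼 → V} {C : ℝ≥0} (hf : LipschitzWith C f) {s : Set 𝔼}
    (hsm : MeasurableSet s) (hs : s ⊆ regularSet f) {K : ℝ≥0}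
    (hK : ∀ x ∈ s, ∀ y ∈ s, dist x y ≤ K * dist (f x) (f y)) {S : Set V}
    (hS : NullMeasurableSet S (μHE[m] : Measure V))
    (hfin : ∀ T : Set V, IsCompact T → (μHE[m] : Measure V) (S ∩ T) < ∞) :
    ∀ᵐ y ∂((μHE[m] : Measure V).restrict S), ∀ x ∈ s, f x = y →
      IsApproxTangentSpace m S y (fderiv ℝ f x).range := by
  obtain ⟨S₀, hS₀S, hS₀m, hS₀⟩ := hS.exists_measurable_subset_ae_eq
  have hr : (μHE[m] : Measure V).restrict S = (μHE[m] : Measure V).restrict S₀ :=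
    Measure.restrict_congr_set hS₀.symm
  have hloc : IsLocallyFiniteMeasure ((μHE[m] : Measure V).restrict S₀) := by
    have : IsFiniteMeasureOnCompacts ((μHE[m] : Measure V).restrict S₀) := by
      refine ⟨fun T hT => ?_⟩
      rw [Measure.restrict_apply hT.measurableSet, Set.inter_comm]
      exact (measure_mono (Set.inter_subset_inter_left _ hS₀S)).trans_lt (hfin T hT)
    exact isLocallyFiniteMeasure_of_isFiniteMeasureOnCompacts
  rw [hr]
  -- Only the part of s mapped into S₀ is kept: its image lies inside the set whose tangent space is
  -- sought, and has the same points over S₀.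
  let s' := s ∩ f ⁻¹' S₀
  have hs'm : MeasurableSet s' := hsm.inter (hf.continuous.measurable hS₀m)
  have hs' : s' ⊆ regularSet f := Set.inter_subset_left.trans hs
  have hK' : ∀ x ∈ s', ∀ y ∈ s', dist x y ≤ K * dist (f x) (f y) :=
    fun x hx y hy => hK x hx.1 y hy.1
  have hB : MeasurableSet (f '' s') :=
    measurableSet_image_of_subset_regularSet hs'm hs' (injOn_of_dist_le hK')
  have hBS : f '' s' ⊆ S₀ := by
    rintro _ ⟨x, hx, rfl⟩
    exact hx.2
  have h1 := ae_tendsto_diff_image hf hK' hB hBS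
  have h2 := ae_tendsto_blowup_image hf hs'm hs' hK'
  set N := {x | ¬ (x ∈ s' → ∀ φ : V → ℝ, Continuous φ → HasCompactSupport φ →
      Tendsto (fun r : ℝ => (r ^ m)⁻¹ * ∫ z in f '' s', φ (r⁻¹ • (z - f x)) ∂μHE[m]) (𝓝[>] 0)
        (𝓝 (∫ z in ((fderiv ℝ f x).range : Set V), φ z ∂μHE[m])))}
  have hN : volume N = 0 := h2
  -- Lipschitz maps send null sets to null sets, so the exceptional x become exceptional y, and
  -- every preimage of a remaining y is good.
  have hfN : (μHE[m] : Measure V) (f '' N) = 0 := by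
    refine le_antisymm ((hf.euclideanHausdorffMeasure_image_le_volume _).trans ?_) zero_le
    rw [hN, mul_zero]
  have h3 : ∀ᵐ y ∂(μHE[m] : Measure V), y ∉ f '' N := measure_eq_zero_iff_ae_notMem.1 hfN
  have h1' : ∀ᵐ y ∂(μHE[m] : Measure V), y ∈ f '' s' → Tendsto (fun r : ℝ => (r ^ m)⁻¹ *
        ((μHE[m] : Measure V).restrict S₀).real (Metric.closedBall y r \ f '' s'))
        (𝓝[>] 0) (𝓝 0) := by
    filter_upwards [(ae_restrict_iff' hB).1 h1] with y hy hyB using hy hyB hyB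
  refine (ae_restrict_iff' hS₀m).2 ?_
  filter_upwards [h3, h1'] with y hyN hy hyS x hx hxy
  subst hxy
  have hxs' : x ∈ s' := ⟨hx, hyS⟩
  have hxN : x ∉ N := fun h => hyN ⟨x, h, rfl⟩
  simp only [N, Set.mem_ofPred_eq, not_not] at hxN
  refine (isApproxTangentSpace_of_subset hB hBS ⟨?_, hxN hxs'⟩
    (hy ⟨x, hxs', rfl⟩)).congr_restrict hr
  rw [LinearMap.finrank_range_of_inj (hs hx).2, finrank_euclideanSpace_fin]

end ApproxTangent

/-! ### Measurability and homogeneity of densities along differentials -/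

section Densities

variable {m : ℕ} {V : Type*} [NormedAddCommGroup V] [InnerProductSpace ℝ V]
  [FiniteDimensional ℝ V]

local notation "𝔼" => EuclideanSpace ℝ (Fin m)

omit [FiniteDimensional ℝ V] in
theorem jacobian_eq {F : ⋀[ℝ]^m 𝔼 → ℝ} (hF : IsLinearDensity F) {G : ⋀[ℝ]^m V → ℝ}
    (hG : IsLinearDensity G) (L : 𝔼 →L[ℝ] V) :
    jacobian L.toLinearMap F G = (F (stdVec m))⁻¹ * G (pushVec L) := by
  rw [jacobian, unitVec, map_smul]
  exact hG.homogeneous _ (inv_nonneg.2 (hF.nonneg _ (isSimple_stdVec m))) _ (isSimple_pushVec L)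

theorem IsLinearDensity.apply_stdVec_pos {F : ⋀[ℝ]^m 𝔼 → ℝ} (hF : IsLinearDensity F) :
    0 < F (stdVec m) := by
  refine (hF.nonneg _ (isSimple_stdVec m)).lt_of_ne' ?_
  rw [Ne, hF.eq_zero_iff _ (isSimple_stdVec m), ← norm_eq_zero, norm_stdVec]
  exact one_ne_zero

omit [FiniteDimensional ℝ V] in
theorem IsLinearDensity.apply_zero {k : ℕ} {G : ⋀[ℝ]^k V → ℝ} (hG : IsLinearDensity G) :
    G 0 = 0 := by
  have h : IsSimple (0 : ⋀[ℝ]^k V) := ⟨0, 0, by rw [zero_smul]⟩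
  exact (hG.eq_zero_iff _ h).2 rfl

theorem Density.continuous_apply_pushVec (G : Density m V) :
    Continuous fun p : V × (𝔼 →L[ℝ] V) => G p.1 (pushVec p.2) :=
  G.continuousOn.comp_continuous
    (continuous_fst.prodMk (continuous_pushVec.comp continuous_snd))
    fun p => isSimple_pushVec p.2

theorem Density.measurable_apply_stdVec (F : Density m 𝔼) :
    Measurable fun x => F x (stdVec m) :=
  (F.continuousOn.comp_continuous (continuous_id.prodMk continuous_const)
    fun _ => isSimple_stdVec m).measurable

theorem Density.measurable_apply_pushVec [MeasurableSpace V] [BorelSpace V] (G : Density m V)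
    {f : 𝔼 → V} (hf : Measurable f) :
    Measurable fun x => G (f x) (pushVec (fderiv ℝ f x)) :=
  G.continuous_apply_pushVec.measurable.comp (hf.prodMk (measurable_fderiv ℝ f))

theorem Density.measurable_jacobian [MeasurableSpace V] [BorelSpace V]
    (F : Density m 𝔼) (G : Density m V) {f : 𝔼 → V} (hf : Measurable f) :
    Measurable fun x => jacobian (fderiv ℝ f x).toLinearMap (F x) (G (f x)) := by
  simp_rw [jacobian_eq (F.isLinearDensity _) (G.isLinearDensity _)]
  exact F.measurable_apply_stdVec.inv.mul (G.measurable_apply_pushVec hf)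

omit [FiniteDimensional ℝ V] in
theorem jacobian_nonneg {F : ⋀[ℝ]^m 𝔼 → ℝ} (hF : IsLinearDensity F) {G : ⋀[ℝ]^m V → ℝ}
    (hG : IsLinearDensity G) (L : 𝔼 →L[ℝ] V) : 0 ≤ jacobian L.toLinearMap F G := by
  rw [jacobian_eq hF hG]
  exact mul_nonneg (inv_nonneg.2 (hF.nonneg _ (isSimple_stdVec m)))
    (hG.nonneg _ (isSimple_pushVec L))

/-- The value of a density on a unit multiple of `Λ^m L (e)`, up to the sign of the multiple. -/
theorem Density.apply_smul_mul_jac (G : Density m V) (y : V) {L : 𝔼 →L[ℝ] V} {a : ℝ}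
    (ha : |a| * jac L = 1) (h : G.IsSymmetric ∨ 0 ≤ a) :
    G y (a • pushVec L) * jac L = G y (pushVec L) := by
  have habs : G y (a • pushVec L) = |a| * G y (pushVec L) := by
    rcases le_or_gt 0 a with h0 | h0
    · rw [abs_of_nonneg h0]
      exact (G.isLinearDensity y).homogeneous a h0 _ (isSimple_pushVec L)
    · rcases h with hs | h'
      · rw [← hs y _ ((isSimple_pushVec L).smul a), ← neg_smul, abs_of_neg h0]
        exact (G.isLinearDensity y).homogeneous (-a) (neg_nonneg.2 h0.le) _ (isSimple_pushVec L)
      · exact absurd h' (not_le.2 h0)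
  rw [habs, mul_right_comm, ha, one_mul]

end Densities

/-! ### Unit tangent fields of the image -/

section TangentField

variable {m : ℕ} {V : Type*} [NormedAddCommGroup V] [InnerProductSpace ℝ V]
  [FiniteDimensional ℝ V] [MeasurableSpace V] [BorelSpace V]

local notation "𝔼" => EuclideanSpace ℝ (Fin m)

omit [InnerProductSpace ℝ V] [FiniteDimensional ℝ V] in
theorem euclideanHausdorffMeasure_image_null {f : 𝔼 → V} {C : ℝ≥0} (hf : LipschitzWith C f)
    {N : Set 𝔼} (hN : volume N = 0) : μHE[m] (f '' N) = 0 := by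
  refine le_antisymm ((hf.euclideanHausdorffMeasure_image_le_volume _).trans ?_) zero_le
  rw [hN, mul_zero]

/-- Reduction to a Borel set of regular points. The discarded part counts on neither side of the
area formula: its image is null, and the integrand in the domain vanishes there almost everywhere.
-/
theorem exists_measurable_regular_subset {f : 𝔼 → V} {C : ℝ≥0} (hf : LipschitzWith C f)
    {A : Set 𝔼} (hA : NullMeasurableSet A volume) :
    ∃ S ⊆ A, MeasurableSet S ∧ S ⊆ regularSet f ∧ μHE[m] (f '' (A \ S)) = 0 ∧
      ∀ᵐ x, x ∈ A \ S → pushVec (fderiv ℝ f x) = 0 := by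
  obtain ⟨A₀, hA₀A, hA₀m, hA₀⟩ := hA.exists_measurable_subset_ae_eq
  have hnull : volume (A \ A₀) = 0 := (ae_eq_set.1 hA₀).2
  refine ⟨A₀ ∩ regularSet f, Set.inter_subset_left.trans hA₀A,
    hA₀m.inter (measurableSet_regularSet f), Set.inter_subset_right, ?_, ?_⟩
  · have hsub : A \ (A₀ ∩ regularSet f) ⊆ (A \ A₀) ∪ (regularSet f)ᶜ := by
      intro x hx
      by_cases h : x ∈ A₀
      · exact Or.inr fun hr => hx.2 ⟨h, hr⟩
      · exact Or.inl ⟨hx.1, h⟩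
    refine measure_mono_null (Set.image_mono hsub) ?_
    rw [Set.image_union, measure_union_null_iff]
    exact ⟨euclideanHausdorffMeasure_image_null hf hnull,
      euclideanHausdorffMeasure_image_diff_regularSet hf⟩
  · filter_upwards [hf.ae_differentiableAt, measure_eq_zero_iff_ae_notMem.1 hnull]
      with x hd hx hxA
    rw [pushVec_eq_zero_iff]
    intro hi
    refine hxA.2 ⟨?_, hd, hi⟩
    by_contra h
    exact hx ⟨hxA.1, h⟩

theorem measurableSet_image_of_subset {f : 𝔼 → V} {S : Set 𝔼} (hSm : MeasurableSet S)
    (hS : S ⊆ regularSet f) : MeasurableSet (f '' S) := by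
  obtain ⟨P, -, hm, hU, hK⟩ := exists_partition_injOn f hSm hS
  rw [← hU, Set.image_iUnion]
  exact MeasurableSet.iUnion fun n => measurableSet_image_of_subset_regularSet (hm n)
    ((Set.subset_iUnion P n).trans (hU.le.trans hS)) (injOn_of_dist_le (hK n).choose_spec)

omit [InnerProductSpace ℝ V] [FiniteDimensional ℝ V] in
theorem image_ae_eq_of_null {f : 𝔼 → V} {A S : Set 𝔼} (hSA : S ⊆ A)
    (h0 : μHE[m] (f '' (A \ S)) = 0) : f '' A =ᵐ[(μHE[m] : Measure V)] f '' S := by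
  have h : f '' A = f '' S ∪ f '' (A \ S) := by
    rw [← Set.image_union, Set.union_sdiff_cancel hSA]
  rw [h]
  exact union_ae_eq_left_of_ae_eq_empty (ae_eq_empty.2 h0)

theorem nullMeasurableSet_image {f : 𝔼 → V} {C : ℝ≥0} (hf : LipschitzWith C f)
    {A : Set 𝔼} (hA : NullMeasurableSet A volume) :
    NullMeasurableSet (f '' A) (μHE[m] : Measure V) := by
  obtain ⟨S, hSA, hSm, hS, h0, -⟩ := exists_measurable_regular_subset hf hA
  exact (measurableSet_image_of_subset hSm hS).nullMeasurableSet.congr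
    (image_ae_eq_of_null hSA h0).symm

theorem ae_isApproxTangentSpace_of_subset_regularSet {f : 𝔼 → V} {C : ℝ≥0}
    (hf : LipschitzWith C f) {S : Set 𝔼} (hSm : MeasurableSet S) (hS : S ⊆ regularSet f)
    {T : Set V} (hT : NullMeasurableSet T (μHE[m] : Measure V))
    (hfin : ∀ K : Set V, IsCompact K → (μHE[m] : Measure V) (T ∩ K) < ∞) :
    ∀ᵐ y ∂((μHE[m] : Measure V).restrict T), ∀ x ∈ S, f x = y →
      IsApproxTangentSpace m T y (fderiv ℝ f x).range := by
  obtain ⟨P, -, hm, hU, hK⟩ := exists_partition_injOn f hSm hS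
  have h : ∀ n, ∀ᵐ y ∂((μHE[m] : Measure V).restrict T), ∀ x ∈ P n, f x = y →
      IsApproxTangentSpace m T y (fderiv ℝ f x).range := fun n =>
    ae_isApproxTangentSpace hf (hm n) ((Set.subset_iUnion P n).trans (hU.le.trans hS))
      (hK n).choose_spec hT hfin
  filter_upwards [ae_all_iff.2 h] with y hy x hx hxy
  rw [← hU] at hx
  obtain ⟨n, hn⟩ := Set.mem_iUnion.1 hx
  exact hy n x hn hxy

theorem exists_isUnitTangentField {f : 𝔼 → V} {C : ℝ≥0} (hf : LipschitzWith C f)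
    {A : Set 𝔼} (hA : NullMeasurableSet A volume) :
    ∃ ξ : V → ⋀[ℝ]^m V, IsUnitTangentField m (f '' A) ξ := by
  obtain ⟨S, hSA, hSm, hS, h0, -⟩ := exists_measurable_regular_subset hf hA
  -- An arbitrary choice of preimage is enough, since a tangent field need not be measurable.
  let k : V → 𝔼 := Function.invFunOn f S
  refine ⟨fun y => (jac (fderiv ℝ f (k y)))⁻¹ • pushVec (fderiv ℝ f (k y)),
    fun T hTA hT hfin => ?_⟩
  have hTmem : ∀ᵐ y ∂((μHE[m] : Measure V).restrict T), y ∈ T := ae_restrict_mem₀ hT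
  filter_upwards [ae_isApproxTangentSpace_of_subset_regularSet hf hSm hS hT hfin, hTmem,
    ae_restrict_of_ae (measure_eq_zero_iff_ae_notMem.1 h0)] with y hy hyT hy0
  have hyS : ∃ x ∈ S, f x = y := by
    obtain ⟨x, hx, rfl⟩ := hTA hyT
    by_cases hxS : x ∈ S
    · exact ⟨x, hxS, rfl⟩
    · exact absurd ⟨x, ⟨hx, hxS⟩, rfl⟩ hy0
  have hkS : k y ∈ S := Function.invFunOn_mem hyS
  have hky : f (k y) = y := Function.invFunOn_eq hyS
  have hpos : 0 < jac (fderiv ℝ f (k y)) := jac_pos_iff.2 (hS hkS).2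
  refine ⟨?_, _, hy _ hkS hky, Submodule.smul_mem _ _ (pushVec_mem_range _)⟩
  rw [norm_smul, norm_pushVec, norm_inv, Real.norm_of_nonneg hpos.le, inv_mul_cancel₀ hpos.ne']

/-- Test the tangent field on the bi-Lipschitz pieces f(P n), which have locally finite measure even
when f(A) does not. Uniqueness identifies the plane of ξ_y with the range of d_xf, and |ξ_y| = 1
fixes the coefficient up to sign. -/
theorem ae_eq_smul_pushVec {f : 𝔼 → V} {C : ℝ≥0} (hf : LipschitzWith C f) {A S : Set 𝔼}
    (hSA : S ⊆ A) (hSm : MeasurableSet S) (hS : S ⊆ regularSet f)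
    {ξ : V → ⋀[ℝ]^m V} (hξ : IsUnitTangentField m (f '' A) ξ) :
    ∀ᵐ y ∂(μHE[m] : Measure V), ∀ x ∈ S, f x = y →
      ∃ a : ℝ, ξ y = a • pushVec (fderiv ℝ f x) ∧ |a| * jac (fderiv ℝ f x) = 1 := by
  obtain ⟨P, -, hm, hU, hK⟩ := exists_partition_injOn f hSm hS
  have h : ∀ n, ∀ᵐ y ∂(μHE[m] : Measure V), ∀ x ∈ P n, f x = y →
      ∃ a : ℝ, ξ y = a • pushVec (fderiv ℝ f x) ∧ |a| * jac (fderiv ℝ f x) = 1 := by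
    intro n
    obtain ⟨K, hKn⟩ := hK n
    have hPS : P n ⊆ S := (Set.subset_iUnion P n).trans hU.le
    have himg : MeasurableSet (f '' P n) := measurableSet_image_of_subset (hm n) (hPS.trans hS)
    have hfin : ∀ T : Set V, IsCompact T → (μHE[m] : Measure V) (f '' P n ∩ T) < ∞ := by
      intro T hT
      rcases (P n).eq_empty_or_nonempty with he | ⟨x, hx⟩
      · simp [he]
      · obtain ⟨r, hr⟩ := hT.isBounded.subset_closedBall (f x)
        have hsub : f '' P n ∩ T ⊆ f '' P n ∩ Metric.closedBall (f x) (max r 0) :=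
          Set.inter_subset_inter_right _
            (hr.trans (Metric.closedBall_subset_closedBall (le_max_left _ _)))
        exact (measure_mono hsub).trans_lt
          ((euclideanHausdorffMeasure_image_inter_closedBall_le hf hKn hx
            (le_max_right _ _)).trans_lt ENNReal.ofReal_lt_top)
    have h1 := hξ (f '' P n) (Set.image_mono (hPS.trans hSA)) himg.nullMeasurableSet hfin
    have h2 := ae_isApproxTangentSpace hf (hm n) (hPS.trans hS) hKn himg.nullMeasurableSet hfin
    filter_upwards [(ae_restrict_iff' himg).1 h1, (ae_restrict_iff' himg).1 h2]
      with y hy1 hy2 x hx hxy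
    have hyP : y ∈ f '' P n := ⟨x, hx, hxy⟩
    obtain ⟨hn, Q, hQ, hmem⟩ := hy1 hyP
    rw [hQ.unique (hy2 hyP x hx hxy)] at hmem
    obtain ⟨a, ha⟩ := exists_eq_smul_pushVec hmem
    refine ⟨a, ha, ?_⟩
    rw [ha, norm_smul, norm_pushVec, Real.norm_eq_abs] at hn
    exact hn
  filter_upwards [ae_all_iff.2 h] with y hy x hx hxy
  rw [← hU] at hx
  obtain ⟨n, hn⟩ := Set.mem_iUnion.1 hx
  exact hy n x hn hxy

theorem ae_density_mul_jac {f : 𝔼 → V} {C : ℝ≥0} (hf : LipschitzWith C f) (G : Density m V)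
    {A S : Set 𝔼} (hSA : S ⊆ A) (hSm : MeasurableSet S) (hS : S ⊆ regularSet f)
    {ξ : V → ⋀[ℝ]^m V} (hξ : IsUnitTangentField m (f '' A) ξ)
    (hor : G.IsSymmetric ∨ IsInducedOrientation f A ξ) :
    ∀ᵐ y ∂((μHE[m] : Measure V).restrict (f '' A)), ∀ x ∈ S, f x = y →
      G y (ξ y) * jac (fderiv ℝ f x) = G y (pushVec (fderiv ℝ f x)) := by
  have h1 := ae_restrict_of_ae (s := f '' A) (ae_eq_smul_pushVec hf hSA hSm hS hξ)
  rcases hor with hsym | hor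
  · filter_upwards [h1] with y hy x hx hxy
    obtain ⟨a, ha, hn⟩ := hy x hx hxy
    rw [ha]
    exact G.apply_smul_mul_jac y hn (Or.inl hsym)
  · filter_upwards [h1, hor] with y hy hyo x hx hxy
    obtain ⟨a, ha, hn⟩ := hy x hx hxy
    have hray : SameRay ℝ (a • pushVec (fderiv ℝ f x)) (pushVec (fderiv ℝ f x)) := by
      rw [← ha]
      exact hyo x ⟨hSA hx, hxy⟩ (hS hx).1 (hS hx).2
    have hne : pushVec (fderiv ℝ f x) ≠ 0 := fun h => pushVec_eq_zero_iff.1 h (hS hx).2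
    rw [ha]
    exact G.apply_smul_mul_jac y hn
      (Or.inr ((sameRay_smul_left_iff.1 hray).resolve_right hne))

/-- Although ξ may be non-measurable, on each injective piece G(y, ξ_y) agrees almost everywhere
with the measurable quotient G(f(x), Λ^m d_xf(e)) / jac, carried over by the inverse of f. -/
theorem aemeasurable_density {f : 𝔼 → V} {C : ℝ≥0} (hf : LipschitzWith C f) (G : Density m V)
    {A : Set 𝔼} (hA : NullMeasurableSet A volume)
    {ξ : V → ⋀[ℝ]^m V} (hξ : IsUnitTangentField m (f '' A) ξ)
    (hor : G.IsSymmetric ∨ IsInducedOrientation f A ξ) :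
    AEMeasurable (fun y => G y (ξ y)) ((μHE[m] : Measure V).restrict (f '' A)) := by
  obtain ⟨S, hSA, hSm, hS, h0, -⟩ := exists_measurable_regular_subset hf hA
  have hdens := ae_density_mul_jac hf G hSA hSm hS hξ hor
  rw [Measure.restrict_congr_set (image_ae_eq_of_null hSA h0)] at hdens ⊢
  obtain ⟨P, -, hm, hU, hK⟩ := exists_partition_injOn f hSm hS
  rw [← hU, Set.image_iUnion, aemeasurable_iUnion_iff]
  intro n
  have hPS : P n ⊆ S := (Set.subset_iUnion P n).trans hU.le
  have hinj : Set.InjOn f (P n) := injOn_of_dist_le (hK n).choose_spec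
  have hemb : MeasurableEmbedding ((P n).domRestrict f) :=
    (continuousOn_of_subset_regularSet (hPS.trans hS)).measurableEmbedding (hm n) hinj
  let g : 𝔼 → ℝ := fun x => G (f x) (pushVec (fderiv ℝ f x)) / jac (fderiv ℝ f x)
  have hg : Measurable g :=
    (G.measurable_apply_pushVec hf.continuous.measurable).div (measurable_jac_fderiv f)
  have hext : Measurable (Function.extend ((P n).domRestrict f) (fun x : P n => g x) 0) :=
    hemb.measurable_extend (hg.comp measurable_subtype_coe) measurable_const
  refine ⟨_, hext, ?_⟩
  have himg : MeasurableSet (f '' P n) := measurableSet_image_of_subset (hm n) (hPS.trans hS)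
  filter_upwards [ae_restrict_mem himg,
    ae_mono (Measure.restrict_mono (Set.image_mono hPS) le_rfl) hdens] with y hyP hy
  obtain ⟨x, hx, rfl⟩ := hyP
  have h1 := hinj.injective.extend_apply (fun x : P n => g x) 0 ⟨x, hx⟩
  rw [Set.domRestrict_apply] at h1
  rw [h1]
  simp only [g]
  rw [← hy x (hPS hx) rfl, mul_div_cancel_right₀ _ (jac_pos_iff.2 (hS (hPS hx)).2).ne']

end TangentField

/-! ### Area formula for densities -/

section AreaFormulaDensities

variable {m : ℕ} {V : Type*} [NormedAddCommGroup V] [InnerProductSpace ℝ V]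
  [FiniteDimensional ℝ V] [MeasurableSpace V] [BorelSpace V]

local notation "𝔼" => EuclideanSpace ℝ (Fin m)

omit [InnerProductSpace ℝ V] [FiniteDimensional ℝ V] in
theorem ae_fiberSum_congr {f : 𝔼 → V} {C : ℝ≥0} (hf : LipschitzWith C f) {A S : Set 𝔼}
    (hSA : S ⊆ A) (h0 : μHE[m] (f '' (A \ S)) = 0) {u v : 𝔼 → ℝ≥0∞}
    (huv : ∀ᵐ x, x ∈ A → u x = v x) :
    fiberSum f A u =ᵐ[(μHE[m] : Measure V)] fiberSum f S v := by
  have hN : volume {x | ¬ (x ∈ A → u x = v x)} = 0 := huv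
  filter_upwards [measure_eq_zero_iff_ae_notMem.1 h0, measure_eq_zero_iff_ae_notMem.1
    (euclideanHausdorffMeasure_image_null hf hN)] with y hy hyN
  have hfib : A ∩ f ⁻¹' {y} = S ∩ f ⁻¹' {y} := by
    refine Set.Subset.antisymm (fun x hx => ⟨?_, hx.2⟩) (Set.inter_subset_inter_left _ hSA)
    by_contra hxS
    exact hy ⟨x, ⟨hx.1, hxS⟩, hx.2⟩
  rw [fiberSum, fiberSum, hfib]
  refine tsum_congr fun x => ?_
  by_contra h
  exact hyN ⟨x, fun hx => h (hx (hSA x.2.1)), x.2.2⟩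

theorem setLIntegral_eq_of_ae_zero {A S : Set 𝔼} (hA : NullMeasurableSet A volume)
    (hSA : S ⊆ A) (hSm : MeasurableSet S) {h : 𝔼 → ℝ≥0∞} (h0 : ∀ᵐ x, x ∈ A \ S → h x = 0) :
    ∫⁻ x in A, h x = ∫⁻ x in S, h x := by
  rw [← lintegral_inter_add_sdiff h A hSm, Set.inter_eq_self_of_subset_right hSA]
  have h1 : ∫⁻ x in A \ S, h x = ∫⁻ _ in A \ S, 0 :=
    lintegral_congr_ae ((ae_restrict_iff'₀ (hA.diff hSm.nullMeasurableSet)).2 h0)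
  rw [h1, lintegral_zero, add_zero]

/-- The weight F(x, e) of the measure cancels the factor F(x, e)⁻¹ of the jacobian, so F drops out.
-/
theorem setLIntegral_jacobian (F : Density m 𝔼) (G : Density m V) {f : 𝔼 → V}
    (hf : Measurable f) {A : Set 𝔼} {u : 𝔼 → ℝ≥0∞} (hu : AEMeasurable u (volume.restrict A)) :
    ∫⁻ x in A, u x * ENNReal.ofReal (jacobian (fderiv ℝ f x).toLinearMap (F x) (G (f x)))
      ∂F.measure = ∫⁻ x in A, u x * ENNReal.ofReal (G (f x) (pushVec (fderiv ℝ f x))) := by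
  rw [Density.measure, restrict_withDensity', lintegral_withDensity_eq_lintegral_mul₀
    F.measurable_apply_stdVec.ennreal_ofReal.aemeasurable
    (g := fun x => u x * ENNReal.ofReal (jacobian (fderiv ℝ f x).toLinearMap (F x) (G (f x))))
    (hu.mul (F.measurable_jacobian G hf).ennreal_ofReal.aemeasurable)]
  refine lintegral_congr fun x => ?_
  have hpos := (F.isLinearDensity x).apply_stdVec_pos
  rw [Pi.mul_apply, mul_left_comm, ← ENNReal.ofReal_mul hpos.le,
    jacobian_eq (F.isLinearDensity _) (G.isLinearDensity _), mul_inv_cancel_left₀ hpos.ne']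

theorem Density.measureOn_absolutelyContinuous (G : Density m V) (S : Set V)
    (ξ : V → ⋀[ℝ]^m V) : G.measureOn S ξ ≪ (μHE[m] : Measure V) :=
  (withDensity_absolutelyContinuous _ _).trans Measure.restrict_le_self.absolutelyContinuous

/-- **Area formula** for densities and nonnegative functions. -/
theorem aemeasurable_fiberSum_and_lintegral {f : 𝔼 → V} {C : ℝ≥0} (hf : LipschitzWith C f)
    (F : Density m 𝔼) (G : Density m V) {A : Set 𝔼} (hA : NullMeasurableSet A volume)
    {ξ : V → ⋀[ℝ]^m V} (hξ : IsUnitTangentField m (f '' A) ξ)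
    (hor : G.IsSymmetric ∨ IsInducedOrientation f A ξ)
    {u : 𝔼 → ℝ≥0∞} (hu : AEMeasurable u (volume.restrict A)) :
    AEMeasurable (fiberSum f A u) (G.measureOn (f '' A) ξ) ∧
      ∫⁻ x in A, u x * ENNReal.ofReal (jacobian (fderiv ℝ f x).toLinearMap (F x) (G (f x)))
        ∂F.measure = ∫⁻ y, fiberSum f A u y ∂(G.measureOn (f '' A) ξ) := by
  obtain ⟨S, hSA, hSm, hS, h0, hpush⟩ := exists_measurable_regular_subset hf hA
  have hfm : Measurable f := hf.continuous.measurable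
  have huv : ∀ᵐ x, x ∈ A → u x = hu.mk u x := (ae_restrict_iff'₀ hA).1 hu.ae_eq_mk
  have hcongr := ae_fiberSum_congr hf hSA h0 huv
  have hmeas := (measurable_fiberSum_and_lintegral hfm hSm hS hu.measurable_mk).1
  have hH : AEMeasurable (fiberSum f A u) (μHE[m] : Measure V) := ⟨_, hmeas, hcongr⟩
  refine ⟨hH.mono_ac (G.measureOn_absolutelyContinuous _ ξ), ?_⟩
  let Φ : 𝔼 → ℝ≥0∞ := fun x => ENNReal.ofReal (G (f x) (pushVec (fderiv ℝ f x)))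
  have hΦ : Measurable Φ := (G.measurable_apply_pushVec hfm).ennreal_ofReal
  -- On S, multiplying g by the Jacobian restores u Φ, while over almost every y the quotient Φ /
  -- jac equals G(y, ξ_y) at every point of the fibre and leaves the sum as a factor.
  let g : 𝔼 → ℝ≥0∞ := fun x => hu.mk u x * (Φ x / ejac (fderiv ℝ f x))
  have hg : Measurable g := hu.measurable_mk.mul (hΦ.div (measurable_ejac_fderiv f))
  obtain ⟨-, hint⟩ := measurable_fiberSum_and_lintegral hfm hSm hS hg
  have hsupp : Function.support (fiberSum f S g) ⊆ f '' S := by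
    intro y hy
    by_contra h
    exact hy (fiberSum_eq_zero h)
  -- both sides equal the integral of `u * Φ` over the regular part of `A`
  have hL : ∫⁻ x in A, u x * ENNReal.ofReal
      (jacobian (fderiv ℝ f x).toLinearMap (F x) (G (f x))) ∂F.measure =
      ∫⁻ x in S, hu.mk u x * Φ x := by
    rw [setLIntegral_jacobian F G hfm hu, setLIntegral_eq_of_ae_zero hA hSA hSm]
    · refine lintegral_congr_ae ?_
      filter_upwards [ae_restrict_of_ae huv, ae_restrict_mem hSm] with x hx hxS
      rw [hx (hSA hxS)]
    · filter_upwards [hpush] with x hx hxA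
      rw [hx hxA, (G.isLinearDensity _).apply_zero, ENNReal.ofReal_zero, mul_zero]
  have hR : ∫⁻ y, fiberSum f A u y ∂(G.measureOn (f '' A) ξ) = ∫⁻ y, fiberSum f S g y ∂μHE[m] := by
    rw [Density.measureOn, lintegral_withDensity_eq_lintegral_mul₀
      (aemeasurable_density hf G hA hξ hor).ennreal_ofReal hH.restrict,
      ← setLIntegral_eq_of_support_subset hsupp,
      ← setLIntegral_congr (image_ae_eq_of_null hSA h0)]
    refine lintegral_congr_ae ?_
    filter_upwards [ae_density_mul_jac hf G hSA hSm hS hξ hor, ae_restrict_of_ae hcongr]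
      with y hy hyc
    rw [Pi.mul_apply, hyc, fiberSum, fiberSum, ← ENNReal.tsum_mul_left]
    refine tsum_congr fun x => ?_
    have hpos : 0 < jac (fderiv ℝ f x) := jac_pos_iff.2 (hS x.2.1).2
    have hx : f x = y := x.2.2
    simp only [g, Φ]
    rw [hx, ← hy x x.2.1 hx, ENNReal.ofReal_mul' hpos.le, ENNReal.mul_div_cancel_right
      (ENNReal.ofReal_pos.2 hpos).ne' ENNReal.ofReal_ne_top, mul_comm]
  rw [hL, hR, hint]
  refine setLIntegral_congr_fun hSm fun x hx => ?_
  have hpos : 0 < jac (fderiv ℝ f x) := jac_pos_iff.2 (hS hx).2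
  simp only [g]
  rw [mul_assoc, ENNReal.div_mul_cancel (ENNReal.ofReal_pos.2 hpos).ne' ENNReal.ofReal_ne_top]

/-- **Area formula** for densities and functions with integrable product with the Jacobian. -/
theorem summable_fiber_and_integral {f : 𝔼 → V} {C : ℝ≥0} (hf : LipschitzWith C f)
    (F : Density m 𝔼) (G : Density m V) {A : Set 𝔼} (hA : NullMeasurableSet A volume)
    {ξ : V → ⋀[ℝ]^m V} (hξ : IsUnitTangentField m (f '' A) ξ)
    (hor : G.IsSymmetric ∨ IsInducedOrientation f A ξ)
    {u : 𝔼 → ℝ} (hu : AEMeasurable u (volume.restrict A))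
    (hint : IntegrableOn (fun x => u x * jacobian (fderiv ℝ f x).toLinearMap (F x) (G (f x)))
      A F.measure) :
    (∀ᵐ y ∂(G.measureOn (f '' A) ξ), Summable (fun x : ↥(A ∩ f ⁻¹' {y}) => u x)) ∧
      Integrable (fun y => ∑' x : ↥(A ∩ f ⁻¹' {y}), u x) (G.measureOn (f '' A) ξ) ∧
      ∫ x in A, u x * jacobian (fderiv ℝ f x).toLinearMap (F x) (G (f x)) ∂F.measure =
        ∫ y, ∑' x : ↥(A ∩ f ⁻¹' {y}), u x ∂(G.measureOn (f '' A) ξ) := by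
  -- P and Q are the fibre sums of the positive and negative parts of u. Both have finite integral,
  -- hence are finite almost everywhere, which makes the fibre sum of u summable with value P - Q.
  obtain ⟨hPm, hPi⟩ := aemeasurable_fiberSum_and_lintegral hf F G hA hξ hor hu.ennreal_ofReal
  obtain ⟨hQm, hQi⟩ := aemeasurable_fiberSum_and_lintegral hf F G hA hξ hor hu.neg.ennreal_ofReal
  set P := fiberSum f A fun x => ENNReal.ofReal (u x)
  set Q := fiberSum f A fun x => ENNReal.ofReal ((-u) x)
  have hJ : ∀ x, 0 ≤ jacobian (fderiv ℝ f x).toLinearMap (F x) (G (f x)) := fun x =>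
    jacobian_nonneg (F.isLinearDensity _) (G.isLinearDensity _) _
  simp_rw [← ENNReal.ofReal_mul' (hJ _)] at hPi hQi
  have hPfin : ∫⁻ y, P y ∂(G.measureOn (f '' A) ξ) ≠ ∞ := by
    rw [← hPi]
    exact hint.lintegral_lt_top.ne
  have hQfin : ∫⁻ y, Q y ∂(G.measureOn (f '' A) ξ) ≠ ∞ := by
    rw [← hQi]
    have h := hint.neg.lintegral_lt_top.ne
    simpa only [Pi.neg_apply, neg_mul] using h
  have hPt := ae_lt_top' hPm hPfin
  have hQt := ae_lt_top' hQm hQfin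
  have hkey : ∀ᵐ y ∂(G.measureOn (f '' A) ξ),
      HasSum (fun x : ↥(A ∩ f ⁻¹' {y}) => u x) ((P y).toReal - (Q y).toReal) := by
    filter_upwards [hPt, hQt] with y hy1 hy2
    have h1 := ENNReal.hasSum_toReal hy1.ne
    have h2 := ENNReal.hasSum_toReal hy2.ne
    rw [← ENNReal.tsum_toReal_eq fun _ => ENNReal.ofReal_ne_top] at h1 h2
    refine (h1.sub h2).congr_fun fun x => ?_
    simp only [Pi.neg_apply, ENNReal.toReal_ofReal', max_zero_sub_max_neg_zero_eq_self]
  have hae : (fun y => ∑' x : ↥(A ∩ f ⁻¹' {y}), u x) =ᵐ[G.measureOn (f '' A) ξ]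
      fun y => (P y).toReal - (Q y).toReal := hkey.mono fun y hy => hy.tsum_eq
  have hPI := integrable_toReal_of_lintegral_ne_top hPm hPfin
  have hQI := integrable_toReal_of_lintegral_ne_top hQm hQfin
  refine ⟨hkey.mono fun y hy => hy.summable, (hPI.sub hQI).congr hae.symm, ?_⟩
  rw [integral_congr_ae hae, integral_sub hPI hQI, integral_toReal hPm hPt,
    integral_toReal hQm hQt, integral_eq_lintegral_pos_part_sub_lintegral_neg_part hint, hPi]
  congr 2
  rw [← hQi]
  simp only [Pi.neg_apply, neg_mul]

end AreaFormulaDensities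

end AreaFormula

end

/-! ### The area formula in Euclidean space -/

theorem mainTheorem2 {m n : ℕ} (hmn : m ≤ n)
    (f : EuclideanSpace ℝ (Fin m) → EuclideanSpace ℝ (Fin n)) (hf : ∃ C : ℝ≥0, LipschitzWith C f)
    (F : AreaFormula.Density m (EuclideanSpace ℝ (Fin m)))
    (G : AreaFormula.Density m (EuclideanSpace ℝ (Fin n)))
    (A : Set (EuclideanSpace ℝ (Fin m))) (hA : NullMeasurableSet A volume) :
    -- `f(A)` is Hausdorff measurable and has a tangent space almost everywhere
    NullMeasurableSet (f '' A) (μHE[m] : Measure (EuclideanSpace ℝ (Fin n))) ∧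
    (∃ ξ, AreaFormula.IsUnitTangentField m (f '' A) ξ) ∧
    -- `x ↦ J(d_x f; F, G)` is measurable
    AEMeasurable (fun x => AreaFormula.jacobian (fderiv ℝ f x).toLinearMap (F x) (G (f x)))
      F.measure ∧
    -- for every choice of the unit tangent `m`-vectors if `G` is symmetric, and for the one given
    -- by the orientation induced by `f` otherwise
    ∀ ξ : EuclideanSpace ℝ (Fin n) → ⋀[ℝ]^m (EuclideanSpace ℝ (Fin n)),
      AreaFormula.IsUnitTangentField m (f '' A) ξ →
      (G.IsSymmetric ∨ AreaFormula.IsInducedOrientation f A ξ) →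
      AEMeasurable (fun y => G y (ξ y))
        ((μHE[m] : Measure (EuclideanSpace ℝ (Fin n))).restrict (f '' A)) ∧
      -- (a)
      (AEMeasurable (fun y => ((A ∩ f ⁻¹' {y}).encard : ℝ≥0∞)) (G.measureOn (f '' A) ξ) ∧
        ∫⁻ x in A, ENNReal.ofReal
            (AreaFormula.jacobian (fderiv ℝ f x).toLinearMap (F x) (G (f x))) ∂F.measure
          = ∫⁻ y, ((A ∩ f ⁻¹' {y}).encard : ℝ≥0∞) ∂(G.measureOn (f '' A) ξ)) ∧
      -- (b), for nonnegative measurable functions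
      (∀ u : EuclideanSpace ℝ (Fin m) → ℝ≥0∞, AEMeasurable u (volume.restrict A) →
        AEMeasurable (fun y => ∑' x : ↥(A ∩ f ⁻¹' {y}), u x) (G.measureOn (f '' A) ξ) ∧
        ∫⁻ x in A, u x * ENNReal.ofReal
            (AreaFormula.jacobian (fderiv ℝ f x).toLinearMap (F x) (G (f x))) ∂F.measure
          = ∫⁻ y, ∑' x : ↥(A ∩ f ⁻¹' {y}), u x ∂(G.measureOn (f '' A) ξ)) ∧
      -- (b), for measurable functions such that the integrand on the left is `F`-integrable
      (∀ u : EuclideanSpace ℝ (Fin m) → ℝ, AEMeasurable u (volume.restrict A) →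
        IntegrableOn
          (fun x => u x * AreaFormula.jacobian (fderiv ℝ f x).toLinearMap (F x) (G (f x)))
          A F.measure →
        (∀ᵐ y ∂(G.measureOn (f '' A) ξ), Summable (fun x : ↥(A ∩ f ⁻¹' {y}) => u x)) ∧
        Integrable (fun y => ∑' x : ↥(A ∩ f ⁻¹' {y}), u x) (G.measureOn (f '' A) ξ) ∧
        ∫ x in A, u x * AreaFormula.jacobian (fderiv ℝ f x).toLinearMap (F x) (G (f x)) ∂F.measure
          = ∫ y, ∑' x : ↥(A ∩ f ⁻¹' {y}), u x ∂(G.measureOn (f '' A) ξ)) := by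
  obtain ⟨C, hC⟩ := hf
  have hfm := hC.continuous.measurable
  refine ⟨AreaFormula.nullMeasurableSet_image hC hA, AreaFormula.exists_isUnitTangentField hC hA,
    (F.measurable_jacobian G hfm).aemeasurable, fun ξ hξ hor => ⟨?_, ?_, fun u hu => ?_,
    fun u hu hint => ?_⟩⟩
  · exact AreaFormula.aemeasurable_density hC G hA hξ hor
  -- Part (a) is the case u = 1, whose fibre sum counts points.
  · have h := AreaFormula.aemeasurable_fiberSum_and_lintegral hC F G hA hξ hor
      (u := fun _ => 1) aemeasurable_const
    have h1 : AreaFormula.fiberSum f A (fun _ => 1) =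
        fun y => ((A ∩ f ⁻¹' {y}).encard : ℝ≥0∞) := funext fun y => ENNReal.tsum_set_one _
    simpa only [h1, one_mul] using h
  · exact AreaFormula.aemeasurable_fiberSum_and_lintegral hC F G hA hξ hor hu
  · exact AreaFormula.summable_fiber_and_integral hC F G hA hξ hor hu hint
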